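/- Let $p$ be a prime, let $V,W$ be $\mathbb F_p$-vector spaces and let $\beta\colon V\times V\to W$ be an alternating bilinear map. Assume that $(V,W,\beta)$ is \emph{separated}: every finite-dimensional subspace of $V$ has a basis $(v_i)_i$ such that, for all scalars $(\alpha_{ij})_{i<j}$, if $\sum_{i<j}\alpha_{ij}\beta(v_i,v_j)=0$ then for all $i<j$ either $\alpha_{ij}=0$ or $\beta(v_i,v_j)=0$. Let $R=\{(v,v')\in V^2:\beta(v,v')=0\}$. For $n\in\mathbb N$ let $\mathbb A_n$ be the finite set of skew-symmetric $n\times n$ matrices over $\mathbb F_p$, and for $(A,\bar v),(A',\bar v')\in\mathbb A_n\times V^n$ let \[(A,\bar v)\simeq(A',\bar v')\iff \sum_{i<j}a_{ij}\beta(v_i,v_j)=\sum_{i<j}a'_{ij}\beta(v'_i,v'_j).\] Write $(V,+,0,R)^{eq}$ for the many-sorted structure obtained from $(V,+,0,R)$ by adding, as new sorts, the quotients of finite disjoint unions of Cartesian powers of $V$ by $\emptyset$-definable equivalence relations, together with the projection maps (defined on each power $V^{m}$ in the union). Then the relations $\simeq$ are $\emptyset$-definable in $(V,+,0,R)$; thus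 $B_n=(\mathbb A_n\times V^n)/{\simeq}$, with one extra point $u$ ("undetermined") added, is a sort of $(V,+,0,R)^{eq}$, and for $A\in\mathbb A_n$ the map $\pi_A\colon V^n\to B_n$, $\bar v\mapsto (A,\bar v)/{\simeq}$, is one of its projections. Let $f_n\colon W\to B_n$ send $w$ to $(A,\bar v)/{\simeq}$ if $w=\sum_{i<j}a_{ij}\beta(v_i,v_j)$ for some $(A,\bar v)\in\mathbb A_n\times V^n$, and to $u$ otherwise. The following hold. 1. The many-sorted structure $\mathcal M=\{(V,+,0,R)^{eq},(W,+,0),\pi_A,f_n;\ n\in\mathbb N,\ A\in\mathbb A_n\}$ eliminates quantifiers relative to $(V,+,0,R)^{eq}$: every formula is equivalent, in $\mathcal M$ (that is, modulo the complete theory of $\mathcal M$), to a Boolean combination of atomic formulas and of formulas $\theta(t_1,\dots,t_k)$, where $\theta$ is a formula of $(V,+,0,R)^{eq}$ and $t_1,\dots,t_k$ are terms of $\mathcal M$. 2. Consequently, every formula $\phi(w_1,\dots,w_m;v_1,\dots,v_k)$ of the two-sorted structure $\{(V,+,0),(W,+,0),\beta\}$, with $w_i$ of sort $W$ and $v_i$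 of sort $V$, is equivalent in it to a Boolean combination of formulas of the form $\sum_i a_iw_i=0$ and of the form $\theta\big(f_n(\sum_i a_{1,i}w_i),\dots,f_n(\sum_i a_{q,i}w_i),\bar v\big)$, where $a_i,a_{j,i}\in\mathbb F_p$ and $\theta$ is a formula of $(V,+,0,R)^{eq}$. 3. Both in $\mathcal M$ and in $\{(V,+,0),(W,+,0),\beta\}$, the sort $V$ is stably embedded, with induced structure $(V,+,0,R)$. That is: for every formula $\phi(\bar x,\bar y)$, with $\bar x$ a tuple of variables of sort $V$ and $\bar y$ a tuple of variables of any sorts, there are finitely many formulas $\psi_1(\bar x,\bar z_1),\dots,\psi_r(\bar x,\bar z_r)$ with all variables $\bar x,\bar z_l$ of sort $V$ such that for every tuple $\bar b$ of parameters there are an $l$ and a tuple $\bar c$ from $V$ for which $\phi(\bar x,\bar b)$ and $\psi_l(\bar x,\bar c)$ define the same subset of $V^{|\bar x|}$; and a subset of $V^k$ is $\emptyset$-definable in the larger structure if and only if it is $\emptyset$-definable in $(V,+,0,R)$. -/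

import Mathlib

/-! ### Many-sorted first-order logic -/

universe u v w

/-- A many-sorted first-order language with set of sorts `S`. -/
structure MSLanguage (S : Type v) where
  /-- function symbols -/
  Func : Type w
  arity : Func → ℕ
  dom : (f : Func) → Fin (arity f) → S
  cod : Func → S
  /-- relation symbols -/
  Rel : Type w
  relArity : Rel → ℕ
  relDom : (r : Rel) → Fin (relArity r) → S

/-- A structure for a many-sorted language (sorts are allowed to be empty). -/
structure MSStructure {S : Type v} (L : MSLanguage.{v, w} S) where
  carrier : S → Type u
  funMap : (f : L.Func) → (∀ i, carrier (L.dom f i)) → carrier (L.cod f)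
  relMap : (r : L.Rel) → (∀ i, carrier (L.relDom r i)) → Prop

section Logic

variable {S : Type v} {L : MSLanguage.{v, w} S}

/-- Terms in the context `σ`: the variables are indexed by `ι`, and the variable `i` has
sort `σ i`. The second index is the sort of the term. -/
inductive MSTerm (L : MSLanguage.{v, w} S) {ι : Type} (σ : ι → S) : S → Type (max v w)
  | var (i : ι) : MSTerm L σ (σ i)
  | func (f : L.Func) (ts : ∀ i, MSTerm L σ (L.dom f i)) : MSTerm L σ (L.cod f)

/-- The context `σ` with one more variable `none`, of sort `s`. -/
def extendContext {ι : Type} (s : S) (σ : ι → S) : Option ι → S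
  | none => s
  | some i => σ i

/-- First-order formulas in the context `σ`. -/
inductive MSFormula (L : MSLanguage.{v, w} S) : {ι : Type} → (ι → S) → Type (max 1 v w)
  | falsum {ι : Type} {σ : ι → S} : MSFormula L σ
  | equal {ι : Type} {σ : ι → S} {s : S} (t t' : MSTerm L σ s) : MSFormula L σ
  | rel {ι : Type} {σ : ι → S} (r : L.Rel) (ts : ∀ i, MSTerm L σ (L.relDom r i)) :
      MSFormula L σ
  | imp {ι : Type} {σ : ι → S} (φ ψ : MSFormula L σ) : MSFormula L σ
  | all {ι : Type} {σ : ι → S} (s : S) (φ : MSFormula L (extendContext s σ)) : MSFormula L σ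

/-- Extension of an assignment by a value for the new variable. -/
def extendAssignment {C : S → Type u} {ι : Type} {σ : ι → S} {s : S} (a : C s)
    (ρ : ∀ i, C (σ i)) : ∀ i, C (extendContext s σ i)
  | none => a
  | some i => ρ i

/-- The value of a term under an assignment. -/
def MSTerm.eval (M : MSStructure.{u} L) {ι : Type} {σ : ι → S} (ρ : ∀ i, M.carrier (σ i)) :
    {s : S} → MSTerm L σ s → M.carrier s
  | _, .var i => ρ i
  | _, .func f ts => M.funMap f fun i => (ts i).eval M ρ

/-- Tarskian satisfaction. -/
def MSFormula.Realize (M : MSStructure.{u} L) :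
    {ι : Type} → {σ : ι → S} → MSFormula L σ → (∀ i, M.carrier (σ i)) → Prop
  | _, _, .falsum, _ => False
  | _, _, .equal t t', ρ => t.eval M ρ = t'.eval M ρ
  | _, _, .rel r ts, ρ => M.relMap r fun i => (ts i).eval M ρ
  | _, _, .imp φ ψ, ρ => φ.Realize M ρ → ψ.Realize M ρ
  | _, _, .all s φ, ρ => ∀ a : M.carrier s, φ.Realize M (extendAssignment a ρ)

/-- The term lives entirely in the sorts of `T`. -/
def MSTerm.IsOver (T : Set S) {ι : Type} {σ : ι → S} : {s : S} → MSTerm L σ s → Prop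
  | _, .var i => σ i ∈ T
  | _, .func f ts => L.cod f ∈ T ∧ ∀ i, (ts i).IsOver T

/-- The formula lives entirely in the sorts of `T`: it is a formula of the restriction of the
language to the sorts of `T`; in particular it quantifies over sorts of `T` only. -/
def MSFormula.IsOver (T : Set S) : {ι : Type} → {σ : ι → S} → MSFormula L σ → Prop
  | _, _, .falsum => True
  | _, _, .equal t t' => t.IsOver T ∧ t'.IsOver T
  | _, _, .rel _ ts => ∀ i, (ts i).IsOver T
  | _, _, .imp φ ψ => φ.IsOver T ∧ ψ.IsOver T
  | _, _, .all s φ => s ∈ T ∧ φ.IsOver T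

/-- The sets defined by formulas which are quantifier-free relative to the sorts of `T`, i.e. by
Boolean combinations of atomic formulas and of formulas `θ(t₁, …, tₙ)`, with `θ` an arbitrary
formula of the restriction of the language to the sorts of `T`, and `t₁, …, tₙ` terms of the full
language. -/
inductive IsRelQFDefinable (M : MSStructure.{u} L) (T : Set S) {ι : Type} (σ : ι → S) :
    Set (∀ i, M.carrier (σ i)) → Prop
  | equal {s : S} (t t' : MSTerm L σ s) :
      IsRelQFDefinable M T σ {ρ | t.eval M ρ = t'.eval M ρ}
  | rel (r : L.Rel) (ts : ∀ i, MSTerm L σ (L.relDom r i)) :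
      IsRelQFDefinable M T σ {ρ | M.relMap r fun i => (ts i).eval M ρ}
  | over {n : ℕ} (τ : Fin n → S) (hτ : ∀ k, τ k ∈ T) (θ : MSFormula L τ) (hθ : θ.IsOver T)
      (t : ∀ k, MSTerm L σ (τ k)) :
      IsRelQFDefinable M T σ {ρ | θ.Realize M fun k => (t k).eval M ρ}
  | compl {X : Set (∀ i, M.carrier (σ i))} (hX : IsRelQFDefinable M T σ X) :
      IsRelQFDefinable M T σ Xᶜ
  | inter {X Y : Set (∀ i, M.carrier (σ i))} (hX : IsRelQFDefinable M T σ X)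
      (hY : IsRelQFDefinable M T σ Y) : IsRelQFDefinable M T σ (X ∩ Y)

/-- `M` eliminates quantifiers relative to the sorts of `T`: every formula is equivalent in `M`
(equivalently, modulo the complete theory of `M`) to one which is quantifier-free relative
to `T`. -/
def EliminatesQuantifiersRelativeTo (M : MSStructure.{u} L) (T : Set S) : Prop :=
  ∀ (ι : Type) (σ : ι → S) (φ : MSFormula L σ), IsRelQFDefinable M T σ {ρ | φ.Realize M ρ}

/-- Concatenation of assignments. -/
def sumAssignment {C : S → Type u} {ι κ : Type} {σ : ι → S} {τ : κ → S}
    (x : ∀ i, C (σ i)) (y : ∀ j, C (τ j)) : ∀ z, C (Sum.elim σ τ z)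
  | .inl i => x i
  | .inr j => y j

/-- The sort `s` is stably embedded in (the complete theory of) `M`: for every formula `φ(x, y)`,
with `x` a tuple of variables of sort `s` and `y` a tuple of variables of any sorts, there are
finitely many formulas `ψ(x, z)` in variables of sort `s` such that each set `φ(M, b)` is of the
form `ψ(M, c)`, for one of these `ψ` and some tuple `c` of elements of the sort `s`.
(That finitely many `ψ` suffice for all `b` expresses, inside `M`, that the property holds in
all models of the theory of `M`.) -/
def IsStablyEmbedded (M : MSStructure.{u} L) (s : S) : Prop :=
  ∀ (k m : ℕ) (σ : Fin m → S) (φ : MSFormula L (Sum.elim (fun _ : Fin k => s) σ)),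
    ∃ Ψ : List (Σ l : ℕ, MSFormula L (Sum.elim (fun _ : Fin k => s) (fun _ : Fin l => s))),
      ∀ b : ∀ j, M.carrier (σ j), ∃ ψ ∈ Ψ, ∃ c : Fin ψ.1 → M.carrier s,
        ∀ x : Fin k → M.carrier s,
          φ.Realize M (sumAssignment x b) ↔ ψ.2.Realize M (sumAssignment x c)

/-- `X ⊆ s^k` is definable without parameters in `M`. -/
def IsSortDefinable (M : MSStructure.{u} L) (s : S) {k : ℕ}
    (X : Set (Fin k → M.carrier s)) : Prop :=
  ∃ φ : MSFormula L (fun _ : Fin k => s), X = {x | φ.Realize M x}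

end Logic

/-! ### Bilinear systems -/

noncomputable section BilinearSystem

variable {p : ℕ} {V W : Type u} [AddCommGroup V] [Module (ZMod p) V]
  [AddCommGroup W] [Module (ZMod p) W]

/-- The bilinear system is separated: every finite-dimensional subspace of `V` has a separated
basis. -/
def IsSeparatedSystem (β : V →ₗ[ZMod p] V →ₗ[ZMod p] W) : Prop :=
  ∀ V' : Submodule (ZMod p) V, Module.Finite (ZMod p) V' →
    ∃ (n : ℕ) (b : Module.Basis (Fin n) (ZMod p) V'),
      ∀ α : Fin n → Fin n → ZMod p,
        (∑ i, ∑ j, if i < j then α i j • β (b i) (b j) else 0) = 0 →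
          ∀ i j, i < j → α i j = 0 ∨ β (b i) (b j) = 0

/-- Function symbols of `(V, +, 0, R)`, by arity. -/
inductive BaseFunc : ℕ → Type
  | zero : BaseFunc 0
  | add : BaseFunc 2

/-- Relation symbols of `(V, +, 0, R)`, by arity. -/
inductive BaseRel : ℕ → Type
  | R : BaseRel 2

/-- The one-sorted language of `(V, +, 0, R)`. -/
def baseLanguage : FirstOrder.Language.{0, 0} := ⟨BaseFunc, BaseRel⟩

/-- The structure `(V, +, 0, R)`, where `R(v₀, v₁)` means `β(v₀, v₁) = 0`. -/
@[reducible] def baseStructure (β : V →ₗ[ZMod p] V →ₗ[ZMod p] W) : baseLanguage.Structure V where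
  funMap := fun {_} f => match f with
    | BaseFunc.zero => fun _ => 0
    | BaseFunc.add => fun x => x 0 + x 1
  RelMap := fun {_} r => match r with
    | BaseRel.R => fun x => β (x 0) (x 1) = 0

/-- Definability without parameters in `(V, +, 0, R)`. -/
def IsBaseDefinable (β : V →ₗ[ZMod p] V →ₗ[ZMod p] W) {α : Type} (X : Set (α → V)) : Prop :=
  letI := baseStructure β
  (∅ : Set V).Definable baseLanguage X

/-- An equivalence relation on a finite disjoint union of Cartesian powers of `V` is definable
without parameters in `(V, +, 0, R)`. -/
def IsBaseDefinableSetoid (β : V →ₗ[ZMod p] V →ₗ[ZMod p] W) {ι : Type} (n : ι → ℕ)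
    (r : Setoid (Σ i, Fin (n i) → V)) : Prop :=
  ∀ i j, IsBaseDefinable β
    {z : Fin (n i) ⊕ Fin (n j) → V | r ⟨i, fun k => z (.inl k)⟩ ⟨j, fun k => z (.inr k)⟩}

/-- The imaginary sorts of `(V, +, 0, R)^eq`: quotients, by equivalence relations definable
without parameters, of `V^n` and more generally of finite disjoint unions of Cartesian powers
of `V`. (Sets of the form `F × V^n` with `F` finite, and sets to which a constant for
"undetermined" is added, are such disjoint unions.) -/
structure ImagSort (β : V →ₗ[ZMod p] V →ₗ[ZMod p] W) where
  ι : Type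
  finite : Finite ι
  n : ι → ℕ
  rel : Setoid (Σ i, Fin (n i) → V)
  definable : IsBaseDefinableSetoid β n rel

/-- The set `𝔸ₙ(𝔽_p)` of skew-symmetric `n × n` matrices. -/
def SkewMatrix (p n : ℕ) : Type := {A : Matrix (Fin n) (Fin n) (ZMod p) // A.transpose = -A}

instance (p n : ℕ) [NeZero p] : Finite (SkewMatrix p n) :=
  inferInstanceAs (Finite {A : Matrix (Fin n) (Fin n) (ZMod p) // A.transpose = -A})

/-- `∑_{i<j} a_{ij} β(v_i, v_j)`. -/
def skewSum (β : V →ₗ[ZMod p] V →ₗ[ZMod p] W) {n : ℕ} (A : SkewMatrix p n) (x : Fin n → V) : W :=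
  ∑ i, ∑ j, if i < j then A.1 i j • β (x i) (x j) else 0

/-- Exponents for the disjoint union `(𝔸ₙ × V^n) ⊔ {u}`, with `{u} = V^0`. -/
def orderExponent (p n : ℕ) : Option (SkewMatrix p n) → ℕ
  | some _ => n
  | none => 0

/-- The map on `(𝔸ₙ × V^n) ⊔ {u}` sending `(A, v)` to `∑_{i<j} a_{ij} β(v_i, v_j)` and `u`
to an additional point `none`. -/
def orderValue (β : V →ₗ[ZMod p] V →ₗ[ZMod p] W) (n : ℕ) :
    (Σ a, Fin (orderExponent p n a) → V) → Option W
  | ⟨some A, x⟩ => some (skewSum β A x)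
  | ⟨none, _⟩ => none

/-- The equivalence relation `≃` on `𝔸ₙ × V^n`, where `(A, v) ≃ (A', v')` if and only if
`∑_{i<j} a_{ij} β(v_i, v_j) = ∑_{i<j} a'_{ij} β(v'_i, v'_j)`, extended to `(𝔸ₙ × V^n) ⊔ {u}` by
making `{u}` a class. -/
def orderSetoid (β : V →ₗ[ZMod p] V →ₗ[ZMod p] W) (n : ℕ) :
    Setoid (Σ a, Fin (orderExponent p n a) → V) :=
  Setoid.ker (orderValue β n)

/-- All the relations `≃` are definable without parameters in `(V, +, 0, R)`. -/
def OrderDefinable (β : V →ₗ[ZMod p] V →ₗ[ZMod p] W) : Prop :=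
  ∀ n, IsBaseDefinableSetoid β (orderExponent p n) (orderSetoid β n)

/-- The sort `Bₙ = (𝔸ₙ × V^n)/≃`, together with the point `u`, as a sort of `(V, +, 0, R)^eq`. -/
def orderSort [NeZero p] (β : V →ₗ[ZMod p] V →ₗ[ZMod p] W) (h : OrderDefinable β) (n : ℕ) :
    ImagSort β where
  ι := Option (SkewMatrix p n)
  finite := inferInstance
  n := orderExponent p n
  rel := orderSetoid β n
  definable := h n

/-- The map `fₙ : W → Bₙ`, which sends `w` to the class of any `(A, v)` with
`w = ∑_{i<j} a_{ij} β(v_i, v_j)`, and to `u` if there is none. -/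
def orderMap (β : V →ₗ[ZMod p] V →ₗ[ZMod p] W) (n : ℕ) (w : W) : Quotient (orderSetoid β n) :=
  open Classical in
  if h : ∃ y : SkewMatrix p n × (Fin n → V), skewSum β y.1 y.2 = w then
    Quotient.mk _ ⟨some h.choose.1, h.choose.2⟩
  else Quotient.mk _ ⟨none, fun i => i.elim0⟩

/-- `fₙ` does not depend on the chosen representation of `w`. -/
theorem orderMap_skewSum (β : V →ₗ[ZMod p] V →ₗ[ZMod p] W) (n : ℕ) (A : SkewMatrix p n)
    (x : Fin n → V) :
    orderMap β n (skewSum β A x) = Quotient.mk (orderSetoid β n) ⟨some A, x⟩ := by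
  have h : ∃ y : SkewMatrix p n × (Fin n → V), skewSum β y.1 y.2 = skewSum β A x := ⟨(A, x), rfl⟩
  rw [orderMap, dif_pos h]
  exact Quotient.sound (congrArg some h.choose_spec)

/-- The sorts of the expansion: `V`, the imaginary sorts of `(V, +, 0, R)`, and `W`. -/
inductive ExpSort (β : V →ₗ[ZMod p] V →ₗ[ZMod p] W)
  | vec
  | imag (E : ImagSort β)
  | target

/-- Function symbols of the expansion: `+` and `0` on `V`, the projections from the components
`V^{n i}` of the imaginary sorts, `+` and `0` on `W`, and the maps `fₙ`. The map `π_A` is the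
projection `proj (orderSort β h n) (some A)`, and the constant `u` of `Bₙ` is
`proj (orderSort β h n) none`. -/
inductive ExpFunc (β : V →ₗ[ZMod p] V →ₗ[ZMod p] W)
  | vecZero
  | vecAdd
  | proj (E : ImagSort β) (i : E.ι)
  | targetZero
  | targetAdd
  | order (n : ℕ)

/-- The relation symbol of the expansion: `R` on `V`. -/
inductive ExpRel : Type w
  | R

/-- The language of `{(V, +, 0, R)^eq, (W, +, 0), π_A, fₙ}`. -/
def expLanguage [NeZero p] (β : V →ₗ[ZMod p] V →ₗ[ZMod p] W) (h : OrderDefinable β) :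
    MSLanguage (ExpSort β) where
  Func := ExpFunc β
  arity
    | .vecZero => 0
    | .vecAdd => 2
    | .proj E i => E.n i
    | .targetZero => 0
    | .targetAdd => 2
    | .order _ => 1
  dom
    | .vecZero => fun _ => .vec
    | .vecAdd => fun _ => .vec
    | .proj _ _ => fun _ => .vec
    | .targetZero => fun _ => .target
    | .targetAdd => fun _ => .target
    | .order _ => fun _ => .target
  cod
    | .vecZero => .vec
    | .vecAdd => .vec
    | .proj E _ => .imag E
    | .targetZero => .target
    | .targetAdd => .target
    | .order n => .imag (orderSort β h n)
  Rel := ExpRel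
  relArity
    | .R => 2
  relDom
    | .R => fun _ => .vec

/-- The carriers of the sorts of the expansion. -/
def expCarrier (β : V →ₗ[ZMod p] V →ₗ[ZMod p] W) : ExpSort β → Type u
  | .vec => V
  | .imag E => Quotient E.rel
  | .target => W

/-- The structure `{(V, +, 0, R)^eq, (W, +, 0), π_A, fₙ}`. -/
def expStructure [NeZero p] (β : V →ₗ[ZMod p] V →ₗ[ZMod p] W) (h : OrderDefinable β) :
    MSStructure.{u} (expLanguage β h) where
  carrier := expCarrier β
  funMap
    | .vecZero => fun _ => (0 : V)
    | .vecAdd => fun x : Fin 2 → V => x 0 + x 1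
    | .proj E i => fun x => Quotient.mk E.rel ⟨i, x⟩
    | .targetZero => fun _ => (0 : W)
    | .targetAdd => fun x : Fin 2 → W => x 0 + x 1
    | .order n => fun x : Fin 1 → W => orderMap β n (x 0)
  relMap
    | .R => fun x : Fin 2 → V => β (x 0) (x 1) = 0

/-- The sorts of `(V, +, 0, R)^eq`. -/
def eqSorts (β : V →ₗ[ZMod p] V →ₗ[ZMod p] W) : Set (ExpSort β) := {s | s ≠ .target}

/-- The two sorts of a bilinear system. -/
inductive SystemSort
  | vec
  | target

/-- Function symbols of a bilinear system. -/
inductive SystemFunc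
  | vecZero
  | vecAdd
  | targetZero
  | targetAdd
  | form

/-- The language of `{(V, +, 0), (W, +, 0), β}`. -/
def systemLanguage : MSLanguage SystemSort where
  Func := SystemFunc
  arity
    | .vecZero => 0
    | .vecAdd => 2
    | .targetZero => 0
    | .targetAdd => 2
    | .form => 2
  dom
    | .vecZero => fun _ => .vec
    | .vecAdd => fun _ => .vec
    | .targetZero => fun _ => .target
    | .targetAdd => fun _ => .target
    | .form => fun _ => .vec
  cod
    | .vecZero => .vec
    | .vecAdd => .vec
    | .targetZero => .target
    | .targetAdd => .target
    | .form => .target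
  Rel := Empty
  relArity := fun r => r.elim
  relDom := fun r => r.elim

/-- The bilinear system `{(V, +, 0), (W, +, 0), β}` as a two-sorted structure. -/
def systemStructure (β : V →ₗ[ZMod p] V →ₗ[ZMod p] W) : MSStructure.{u} systemLanguage where
  carrier
    | .vec => V
    | .target => W
  funMap
    | .vecZero => fun _ => (0 : V)
    | .vecAdd => fun x : Fin 2 → V => x 0 + x 1
    | .targetZero => fun _ => (0 : W)
    | .targetAdd => fun x : Fin 2 → W => x 0 + x 1
    | .form => fun x : Fin 2 → V => β (x 0) (x 1)
  relMap := fun r => r.elim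

/-- Subsets of `W^m × V^k` defined by Boolean combinations of formulas `∑ aᵢ wᵢ = 0` and of
formulas `θ(fₙ(∑ a₁ᵢ wᵢ), …, fₙ(∑ a_qᵢ wᵢ), v)`, with `θ` a formula of `(V, +, 0, R)^eq` and
coefficients in `𝔽_p`. -/
inductive IsNormalForm [NeZero p] (β : V →ₗ[ZMod p] V →ₗ[ZMod p] W) (h : OrderDefinable β)
    (m k : ℕ) : Set ((Fin m → W) × (Fin k → V)) → Prop
  | linear (a : Fin m → ZMod p) : IsNormalForm β h m k {y | ∑ i, a i • y.1 i = 0}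
  | over (n q : ℕ) (a : Fin q → Fin m → ZMod p)
      (θ : MSFormula (expLanguage β h)
        (Sum.elim (fun _ : Fin q => ExpSort.imag (orderSort β h n))
          (fun _ : Fin k => ExpSort.vec)))
      (hθ : θ.IsOver (eqSorts β)) :
      IsNormalForm β h m k {y | θ.Realize (expStructure β h)
        (sumAssignment (C := expCarrier β) (fun j => orderMap β n (∑ i, a j i • y.1 i)) y.2)}
  | compl {X : Set ((Fin m → W) × (Fin k → V))} (hX : IsNormalForm β h m k X) :
      IsNormalForm β h m k Xᶜ
  | inter {X Y : Set ((Fin m → W) × (Fin k → V))} (hX : IsNormalForm β h m k X)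
      (hY : IsNormalForm β h m k Y) : IsNormalForm β h m k (X ∩ Y)

end BilinearSystem

/-!
Let `R` be the relation `β(v, v') = 0`, and say that an element of `W` has order at most `n` if it
is of the form `∑_{i<j} a_{ij} β(v_i, v_j)` with `v` of length `n`.

**Definability of `≃`.** For a tuple `x` in `V`, the kernel of `M ↦ ∑ M_{ij} β(x_i, x_j)` is spanned
by the matrices `c dᵀ` with `R(∑ c_i x_i, ∑ d_j x_j)` (`ker_pairSum`). This is what separatedness
gives, applied to the span of `x`. As `𝔽_p` is finite, it follows that equality of two quadratic
expressions in `x` is definable in `(V, +, 0, R)` (`isBaseDefinable_eq_of_mem_quadratic`), in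
particular `≃` is.

**Coded types.** The sorts of `(V, +, 0, R)^eq` and their finite products are handled through charts
defined on powers of `V` (`Coded`); definable sets and maps between such types are those which are
definable in the charts (`DSet`, `DMap`). A map with values in `W` which is quadratic in each chart
becomes a definable map when it is composed with `f_N : W → B_N`
(`IsChartQuadratic.dMap_orderLift`). Thus `f_N(c w + r)` is a definable function of
`fₙ(w)` and `f_{N+n}(r)` if `w` has order at most `n`
(`orderLift_map₂`).

**Normal forms.** A set of assignments has a normal form if it is given by a definable condition on
finitely many observables: values `fₙ(t)`, with `t` a term of sort `W`, and variables of sorts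
different from `W` (`HasNormalForm`). Equality in `W` has a normal form, because `w = 0` if and only
if `w` has order at most `0`. Quantifiers over the sorts of `(V, +, 0, R)^eq` are harmless. In a
condition on elements `f_N(c_j w + F_j)`, with `w` quantified, either some `c_k w + F_k` with
`c_k ≠ 0` has order at most `N`, and the quantifier over `w` can be replaced by one over `B_N`; or
all the `f_N(c_j w + F_j)` with `c_j ≠ 0` are undetermined (`HasNormalForm.exists_target_aux`). The
latter happens for some `w` if and only if certain translates of the set of elements of order at
most `N` do not cover `W`. Either finitely many translates never cover `W`, or the order is bounded
on the span of the image of `β`; in this case whether they cover `W` can be decided on the sorts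
`Bₙ`, apart from the pattern of the translates which lie in the same coset of the span
(`HasNormalForm.exists_forall_notMem`). Hence every formula of the expansion has a normal form
(`hasNormalForm_realize`), which is relative quantifier elimination.

The formulas of the bilinear system have normal forms too (`hasNormalForm_realize_system`): a term
of sort `W` is the sum of a combination of variables and of an element of bounded order, which is
known through its image in some `Bₙ`.

**Stable embeddedness.** In a normal form, a variable of sort `V` occurs only as itself. Therefore
the trace on `V^k` of a set in normal form is definable in `(V, +, 0, R)` with parameters, which are
the coordinates, in one of finitely many charts, of the observables which depend on the other variables
(`HasNormalForm.exists_list`).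
-/

/-! ### Definability in `(V, +, 0, R)` -/

section BaseDefinability

variable {p : ℕ} {V W : Type u} [AddCommGroup V] [Module (ZMod p) V]
  [AddCommGroup W] [Module (ZMod p) W] {β : V →ₗ[ZMod p] V →ₗ[ZMod p] W}

namespace IsBaseDefinable

variable {α γ : Type}

theorem congr {X Y : Set (α → V)} (hX : IsBaseDefinable β X) (h : ∀ x, x ∈ X ↔ x ∈ Y) :
    IsBaseDefinable β Y :=
  Set.ext h ▸ hX

theorem compl {X : Set (α → V)} (hX : IsBaseDefinable β X) : IsBaseDefinable β Xᶜ := by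
  let _ := baseStructure β
  exact Set.Definable.compl hX

theorem inter {X Y : Set (α → V)} (hX : IsBaseDefinable β X) (hY : IsBaseDefinable β Y) :
    IsBaseDefinable β (X ∩ Y) := by
  let _ := baseStructure β
  exact Set.Definable.inter hX hY

theorem union {X Y : Set (α → V)} (hX : IsBaseDefinable β X) (hY : IsBaseDefinable β Y) :
    IsBaseDefinable β (X ∪ Y) := by
  let _ := baseStructure β
  exact Set.Definable.union hX hY

theorem iUnion {ι : Type*} [Finite ι] {X : ι → Set (α → V)} (hX : ∀ i, IsBaseDefinable β (X i)) :
    IsBaseDefinable β (⋃ i, X i) := by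
  let _ := baseStructure β
  exact Set.definable_iUnion_of_finite hX

theorem iInter {ι : Type*} [Finite ι] {X : ι → Set (α → V)} (hX : ∀ i, IsBaseDefinable β (X i)) :
    IsBaseDefinable β (⋂ i, X i) := by
  let _ := baseStructure β
  exact Set.definable_iInter_of_finite hX

theorem const (P : Prop) : IsBaseDefinable β {_x : α → V | P} := by
  let _ := baseStructure β
  by_cases h : P
  · simp only [h, Set.ofPred_true]
    exact Set.definable_univ
  · simp only [h, Set.ofPred_false]
    exact Set.definable_empty

theorem comp {X : Set (α → V)} (hX : IsBaseDefinable β X) (f : α → γ) :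
    IsBaseDefinable β {x : γ → V | x ∘ f ∈ X} := by
  let _ := baseStructure β
  exact Set.Definable.preimage_comp f hX

theorem exists_sum [Finite γ] {X : Set (α ⊕ γ → V)} (hX : IsBaseDefinable β X) :
    IsBaseDefinable β {x : α → V | ∃ y : γ → V, Sum.elim x y ∈ X} := by
  let _ := baseStructure β
  exact Set.Definable.exists_of_finite hX

end IsBaseDefinable

/-- The linear combinations with coefficients in `ℕ`: the functions on `V^α` given by a term of
`(V, +, 0, R)`. -/
def IsBaseTerm (β : V →ₗ[ZMod p] V →ₗ[ZMod p] W) {α : Type} (f : (α → V) → V) : Prop :=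
  letI := baseStructure β
  ∃ t : baseLanguage.Term α, ∀ x, t.realize x = f x

namespace IsBaseTerm

variable {α : Type}

theorem var (i : α) : IsBaseTerm β fun x : α → V => x i := by
  let _ := baseStructure β
  exact ⟨.var i, fun _ => rfl⟩

theorem zero : IsBaseTerm β fun _ : α → V => 0 := by
  let _ := baseStructure β
  exact ⟨.func (l := 0) BaseFunc.zero fun i => i.elim0, fun _ => rfl⟩

theorem add {f g : (α → V) → V} (hf : IsBaseTerm β f) (hg : IsBaseTerm β g) :
    IsBaseTerm β fun x => f x + g x := by
  let _ := baseStructure β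
  obtain ⟨s, hs⟩ := hf
  obtain ⟨t, ht⟩ := hg
  refine ⟨.func (l := 2) BaseFunc.add ![s, t], fun x => ?_⟩
  change s.realize x + t.realize x = _
  rw [hs, ht]

theorem nsmul {f : (α → V) → V} (hf : IsBaseTerm β f) (n : ℕ) :
    IsBaseTerm β fun x => n • f x := by
  induction n with
  | zero => simpa using zero
  | succ n ih => simpa only [succ_nsmul] using ih.add hf

theorem sum {ι : Type*} (s : Finset ι) {f : ι → (α → V) → V} (hf : ∀ i, IsBaseTerm β (f i)) :
    IsBaseTerm β fun x => ∑ i ∈ s, f i x := by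
  classical
  induction s using Finset.induction_on with
  | empty => simpa using zero
  | insert a s ha ih => simpa only [Finset.sum_insert ha] using (hf a).add ih

theorem smul [NeZero p] {f : (α → V) → V} (hf : IsBaseTerm β f) (c : ZMod p) :
    IsBaseTerm β fun x => c • f x := by
  have := hf.nsmul c.val
  simpa only [← Nat.cast_smul_eq_nsmul (ZMod p), ZMod.natCast_zmod_val] using this

theorem isBaseDefinable_eq {f g : (α → V) → V} (hf : IsBaseTerm β f) (hg : IsBaseTerm β g) :
    IsBaseDefinable β {x | f x = g x} := by
  let _ := baseStructure β
  obtain ⟨s, hs⟩ := hf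
  obtain ⟨t, ht⟩ := hg
  refine Set.empty_definable_iff.2 ⟨s.equal t, ?_⟩
  ext x
  rw [Set.mem_ofPred_eq, Set.mem_ofPred_eq, FirstOrder.Language.Formula.realize_equal, hs, ht]

theorem isBaseDefinable_apply_eq_zero {f g : (α → V) → V} (hf : IsBaseTerm β f)
    (hg : IsBaseTerm β g) : IsBaseDefinable β {x | β (f x) (g x) = 0} := by
  let _ := baseStructure β
  obtain ⟨s, hs⟩ := hf
  obtain ⟨t, ht⟩ := hg
  refine Set.empty_definable_iff.2
    ⟨FirstOrder.Language.Relations.formula₂ (L := baseLanguage) BaseRel.R s t, ?_⟩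
  ext x
  change β (f x) (g x) = 0 ↔ _
  rw [← hs, ← ht]
  exact (FirstOrder.Language.Formula.realize_rel₂ (L := baseLanguage) (M := V)
    (R := BaseRel.R)).symm

end IsBaseTerm

/-! ### Quadratic expressions -/

/-- `∑_{i,j} M_{ij} β(x_i, x_j)`, as a linear function of the matrix `M`. -/
def pairSum (β : V →ₗ[ZMod p] V →ₗ[ZMod p] W) {ι : Type} [Fintype ι] (x : ι → V) :
    Matrix ι ι (ZMod p) →ₗ[ZMod p] W where
  toFun M := ∑ i, ∑ j, M i j • β (x i) (x j)
  map_add' M N := by simp [add_smul, Finset.sum_add_distrib]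
  map_smul' c M := by simp [mul_smul, Finset.smul_sum]

theorem pairSum_apply {ι : Type} [Fintype ι] (x : ι → V) (M : Matrix ι ι (ZMod p)) :
    pairSum β x M = ∑ i, ∑ j, M i j • β (x i) (x j) := rfl

theorem pairSum_vecMulVec {ι : Type} [Fintype ι] (x : ι → V) (c d : ι → ZMod p) :
    pairSum β x (Matrix.vecMulVec c d) = β (∑ i, c i • x i) (∑ j, d j • x j) := by
  simp only [pairSum_apply, Matrix.vecMulVec_apply, map_sum, LinearMap.sum_apply, map_smul,
    LinearMap.smul_apply, mul_smul]
  rw [Finset.sum_comm]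
  refine Finset.sum_congr rfl fun i _ => ?_
  rw [Finset.smul_sum]
  exact Finset.sum_congr rfl fun j _ => smul_comm _ _ _

theorem sum_sum_eq_diag_add_lt {M : Type*} [AddCommMonoid M] {n : ℕ} (F : Fin n → Fin n → M) :
    ∑ i, ∑ j, F i j = ∑ i, F i i + ∑ i, ∑ j, if i < j then F i j + F j i else 0 := by
  have h : ∀ i j, F i j = ((if i = j then F i i else 0) + (if i < j then F i j else 0)) +
      (if j < i then F i j else 0) := by
    intro i j
    rcases lt_trichotomy i j with h | h | h
    · simp [h, h.ne, h.not_gt]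
    · simp [h]
    · simp [h, h.ne', h.not_gt]
  have h2 : ∀ i j, (if i < j then F i j + F j i else 0) =
      (if i < j then F i j else 0) + if i < j then F j i else 0 := by
    intro i j; split_ifs <;> simp
  simp_rw [h2, Finset.sum_add_distrib]
  rw [Finset.sum_comm (f := fun i j => if i < j then F j i else 0), ← add_assoc]
  rw [Finset.sum_congr rfl fun i _ => Finset.sum_congr rfl fun j _ => h i j]
  simp only [Finset.sum_add_distrib, Finset.sum_ite_eq, Finset.mem_univ, if_true]

/-- Change of variables in a quadratic expression. -/
theorem sum_smul_apply_sum {X U : Type*} [AddCommGroup X] [Module (ZMod p) X] [AddCommGroup U]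
    [Module (ZMod p) U] {ι κ : Type} [Fintype ι] [Fintype κ] (M : Matrix ι ι (ZMod p))
    (D : ι → κ → ZMod p) (C : κ → X) (F : X →ₗ[ZMod p] X →ₗ[ZMod p] U) :
    ∑ i, ∑ j, M i j • F (∑ k, D i k • C k) (∑ k, D j k • C k) =
      ∑ k, ∑ l, (∑ i, ∑ j, M i j * D i k * D j l) • F (C k) (C l) := by
  have hF : ∀ i j, F (∑ k, D i k • C k) (∑ k, D j k • C k) =
      ∑ k, ∑ l, (D i k * D j l) • F (C k) (C l) := by
    intro i j
    simp only [map_sum, LinearMap.sum_apply, map_smul, LinearMap.smul_apply, Finset.smul_sum,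
      mul_smul]
    rw [Finset.sum_comm]
    exact Finset.sum_congr rfl fun k _ => Finset.sum_congr rfl fun l _ => smul_comm _ _ _
  simp only [hF, Finset.smul_sum, Finset.sum_smul, smul_smul, mul_assoc]
  calc _ = ∑ i, ∑ k, ∑ j, ∑ l, (M i j * (D i k * D j l)) • F (C k) (C l) :=
          Finset.sum_congr rfl fun i _ => Finset.sum_comm
    _ = ∑ k, ∑ i, ∑ l, ∑ j, (M i j * (D i k * D j l)) • F (C k) (C l) := by
          rw [Finset.sum_comm]
          exact Finset.sum_congr rfl fun k _ => Finset.sum_congr rfl fun i _ => Finset.sum_comm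
    _ = _ := Finset.sum_congr rfl fun k _ => Finset.sum_comm

/-- The kernel of `M ↦ ∑ M_{ij} β(x_i, x_j)` is generated by the matrices `c dᵀ` which it contains.
This is where separatedness enters: a linear relation between the values `β(b_i, b_j)` at a
separated basis `b` of the span of `x` is a combination of the trivial ones. Hence the kernel is
determined by the restriction of `R` to the (finite) span of `x`. -/
theorem ker_pairSum (halt : β.IsAlt) (hsep : IsSeparatedSystem β) {ι : Type} [Fintype ι]
    (x : ι → V) :
    LinearMap.ker (pairSum β x) = Submodule.span (ZMod p)
      {N | ∃ c d : ι → ZMod p, β (∑ i, c i • x i) (∑ j, d j • x j) = 0 ∧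
        N = Matrix.vecMulVec c d} := by
  classical
  set S := Submodule.span (ZMod p) {N | ∃ c d : ι → ZMod p,
    β (∑ i, c i • x i) (∑ j, d j • x j) = 0 ∧ N = Matrix.vecMulVec c d} with hS
  apply le_antisymm
  swap
  · rw [hS, Submodule.span_le]
    rintro N ⟨c, d, h, rfl⟩
    simpa [pairSum_vecMulVec] using h
  intro M hM
  rw [LinearMap.mem_ker] at hM
  let T : (ι → ZMod p) →ₗ[ZMod p] (ι → ZMod p) →ₗ[ZMod p] Matrix ι ι (ZMod p) :=
    LinearMap.mk₂ _ Matrix.vecMulVec Matrix.add_vecMulVec Matrix.smul_vecMulVec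
      Matrix.vecMulVec_add (fun c v w => Matrix.vecMulVec_smul c v w)
  have hT : ∀ c d, β (∑ i, c i • x i) (∑ j, d j • x j) = 0 → T c d ∈ S := fun c d h =>
    Submodule.subset_span ⟨c, d, h, rfl⟩
  obtain ⟨n, b, hb⟩ := hsep (Submodule.span (ZMod p) (Set.range x))
    (Module.Finite.span_of_finite _ (Set.finite_range x))
  have hx : ∀ i, x i ∈ Submodule.span (ZMod p) (Set.range x) := fun i =>
    Submodule.subset_span ⟨i, rfl⟩
  let D : ι → Fin n → ZMod p := fun i k => b.repr ⟨x i, hx i⟩ k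
  have hD : ∀ i, x i = ∑ k, D i k • (b k : V) := by
    intro i
    have := congrArg (Submodule.subtype _) (b.sum_repr ⟨x i, hx i⟩)
    rw [map_sum] at this
    exact this.symm
  have hC : ∀ k, ∃ c : ι → ZMod p, ∑ i, c i • x i = (b k : V) := fun k =>
    (Submodule.mem_span_range_iff_exists_fun _).1 (b k).2
  choose C hC using hC
  let e : ι → ι → ZMod p := fun i => Pi.single i 1
  have he : ∀ i, ∑ j, e i j • x j = x i := by
    intro i
    simp [e, Pi.single_apply, ite_smul]
  -- `q i` is the combination of the coefficient vectors of the basis representing `x i`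
  let q : ι → ι → ZMod p := fun i => ∑ k, D i k • C k
  have hq : ∀ i, ∑ j, q i j • x j = x i := by
    intro i
    conv_rhs => rw [hD i]
    simp only [q, Finset.sum_apply, Pi.smul_apply, smul_eq_mul, Finset.sum_smul, mul_smul]
    rw [Finset.sum_comm]
    exact Finset.sum_congr rfl fun k _ => by rw [← Finset.smul_sum, hC]
  have heq : ∀ i, ∑ j, (e i - q i) j • x j = 0 := by
    intro i
    simp [sub_smul, he, hq]
  have hrep : ∀ i j, T (e i) (e j) - T (q i) (q j) ∈ S := by
    intro i j
    have : T (e i) (e j) - T (q i) (q j) = T (e i - q i) (e j) + T (q i) (e j - q j) := by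
      simp only [map_sub, LinearMap.sub_apply]; abel
    rw [this]
    refine S.add_mem (hT _ _ ?_) (hT _ _ ?_)
    · rw [heq]; simp
    · rw [heq]; simp
  have hMe : M = ∑ i, ∑ j, M i j • T (e i) (e j) := by
    ext a c
    simp [T, e, Matrix.sum_apply, Matrix.vecMulVec_apply, Pi.single_apply]
  let M' : Fin n → Fin n → ZMod p := fun k l => ∑ i, ∑ j, M i j * D i k * D j l
  have hM' : ∀ k l, k < l → M' k l - M' l k = 0 ∨ β (b k) (b l) = 0 := by
    refine hb (fun k l => M' k l - M' l k) ?_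
    have h1 := sum_smul_apply_sum M D (fun k => (b k : V)) β
    simp_rw [← hD] at h1
    rw [← pairSum_apply, hM, sum_sum_eq_diag_add_lt] at h1
    refine Eq.trans ?_ h1.symm
    simp only [halt.self_eq_zero, smul_zero, Finset.sum_const_zero, zero_add]
    refine Finset.sum_congr rfl fun k _ => Finset.sum_congr rfl fun l _ => ?_
    rw [← halt.neg (b k : V) (b l : V)]
    change _ = if k < l then M' k l • _ + M' l k • _ else 0
    rw [smul_neg, ← sub_eq_add_neg, ← sub_smul]
  have hq' : ∑ i, ∑ j, M i j • T (q i) (q j) ∈ S := by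
    rw [sum_smul_apply_sum M D C T, sum_sum_eq_diag_add_lt]
    refine S.add_mem (S.sum_mem fun k _ => S.smul_mem _ (hT _ _ ?_))
      (S.sum_mem fun k _ => S.sum_mem fun l _ => ?_)
    · exact halt.self_eq_zero _
    · split_ifs with hkl
      swap
      · exact S.zero_mem
      rcases hM' k l hkl with h | h
      · -- the symmetric sum of two rank one matrices is a combination of alternating values
        rw [sub_eq_zero] at h
        change M' k l • T (C k) (C l) + M' l k • T (C l) (C k) ∈ S
        rw [h, ← smul_add]
        have h3 : T (C k) (C l) + T (C l) (C k) =
            T (C k + C l) (C k + C l) - T (C k) (C k) - T (C l) (C l) := by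
          simp only [map_add, LinearMap.add_apply]; abel
        rw [h3]
        exact S.smul_mem _ (S.sub_mem (S.sub_mem (hT _ _ (halt.self_eq_zero _))
          (hT _ _ (halt.self_eq_zero _))) (hT _ _ (halt.self_eq_zero _)))
      · refine S.add_mem (S.smul_mem _ (hT _ _ ?_)) (S.smul_mem _ (hT _ _ ?_))
        · rw [hC, hC, h]
        · rw [hC, hC, ← halt.neg, h, neg_zero]
  rw [hMe]
  have : ∑ i, ∑ j, M i j • T (e i) (e j) = ∑ i, ∑ j, M i j • (T (e i) (e j) - T (q i) (q j)) +
      ∑ i, ∑ j, M i j • T (q i) (q j) := by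
    simp only [smul_sub, Finset.sum_sub_distrib, sub_add_cancel]
  rw [this]
  exact S.add_mem (S.sum_mem fun i _ => S.sum_mem fun j _ => S.smul_mem _ (hrep i j)) hq'

/-- Whether a given matrix lies in the kernel of `M ↦ ∑ M_{ij} β(x_i, x_j)` is a definable
condition on `x`: there are finitely many sets of pairs `(c, d)` such that `M` is in the span of the
matrices `c dᵀ`, and the condition says that `R(∑ c_i x_i, ∑ d_j x_j)` holds for all the pairs of
one of them. -/
theorem isBaseDefinable_pairSum_eq_zero [NeZero p] (halt : β.IsAlt) (hsep : IsSeparatedSystem β)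
    {ι : Type} [Fintype ι] (M : Matrix ι ι (ZMod p)) :
    IsBaseDefinable β {x : ι → V | pairSum β x M = 0} := by
  classical
  have : {x : ι → V | pairSum β x M = 0} =
      ⋃ s : {s : Set ((ι → ZMod p) × (ι → ZMod p)) //
          M ∈ Submodule.span (ZMod p) ((fun c => Matrix.vecMulVec c.1 c.2) '' s)},
        ⋂ c : s.1, {x : ι → V | β (∑ i, c.1.1 i • x i) (∑ j, c.1.2 j • x j) = 0} := by
    ext x
    simp only [Set.mem_iUnion, Set.mem_iInter, Set.mem_ofPred_eq, ← LinearMap.mem_ker]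
    constructor
    · rw [ker_pairSum halt hsep]
      refine fun h => ⟨⟨{c | β (∑ i, c.1 i • x i) (∑ j, c.2 j • x j) = 0}, ?_⟩, fun c => c.2⟩
      convert h using 2
      ext N
      constructor
      · rintro ⟨c, hc, rfl⟩
        exact ⟨c.1, c.2, hc, rfl⟩
      · rintro ⟨c, d, h, rfl⟩
        exact ⟨(c, d), h, rfl⟩
    · rintro ⟨⟨s, hs⟩, h⟩
      refine Submodule.span_le.2 ?_ hs
      rintro _ ⟨c, hc, rfl⟩
      rw [SetLike.mem_coe, LinearMap.mem_ker, pairSum_vecMulVec]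
      exact h ⟨c, hc⟩
  rw [this]
  refine IsBaseDefinable.iUnion fun s => IsBaseDefinable.iInter fun c => ?_
  exact IsBaseTerm.isBaseDefinable_apply_eq_zero
    (IsBaseTerm.sum _ fun i => (IsBaseTerm.var i).smul _)
    (IsBaseTerm.sum _ fun i => (IsBaseTerm.var i).smul _)

/-- The functions on `V^α` which are linear combinations of the functions `β(x_i, x_j)`. -/
def quadratic (β : V →ₗ[ZMod p] V →ₗ[ZMod p] W) (α : Type) :
    Submodule (ZMod p) ((α → V) → W) :=
  Submodule.span (ZMod p) (Set.range fun (k : α × α) (x : α → V) => β (x k.1) (x k.2))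

theorem form_mem_quadratic {α : Type} (i j : α) :
    (fun x : α → V => β (x i) (x j)) ∈ quadratic β α :=
  Submodule.subset_span ⟨(i, j), rfl⟩

theorem comp_mem_quadratic {α γ : Type} (f : α → γ) {q : (α → V) → W} (hq : q ∈ quadratic β α) :
    (fun x : γ → V => q (x ∘ f)) ∈ quadratic β γ := by
  have : quadratic β α ≤ (quadratic β γ).comap
      (LinearMap.funLeft (ZMod p) W fun x : γ → V => x ∘ f) := by
    rw [quadratic, Submodule.span_le]
    rintro _ ⟨k, rfl⟩
    exact form_mem_quadratic (f k.1) (f k.2)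
  exact this hq

theorem isBaseDefinable_eq_of_mem_quadratic [NeZero p] (halt : β.IsAlt)
    (hsep : IsSeparatedSystem β) {α : Type} [Finite α] {q r : (α → V) → W}
    (hq : q ∈ quadratic β α) (hr : r ∈ quadratic β α) : IsBaseDefinable β {x | q x = r x} := by
  have := Fintype.ofFinite α
  obtain ⟨c, hc⟩ := (Submodule.mem_span_range_iff_exists_fun _).1 ((quadratic β α).sub_mem hq hr)
  refine (isBaseDefinable_pairSum_eq_zero halt hsep (Matrix.of fun i j => c (i, j))).congr
    fun x => ?_
  change pairSum β x _ = 0 ↔ q x = r x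
  rw [← sub_eq_zero (a := q x), pairSum_apply, ← Pi.sub_apply, ← hc, Finset.sum_apply,
    Fintype.sum_prod_type]
  rfl

theorem skewSum_mem_quadratic {n : ℕ} (A : SkewMatrix p n) :
    skewSum β A ∈ quadratic β (Fin n) := by
  have : skewSum β A = ∑ i, ∑ j, (if i < j then A.1 i j else 0) •
      (fun x : Fin n → V => β (x i) (x j)) := by
    ext x
    simp only [skewSum, Finset.sum_apply, Pi.smul_apply]
    refine Finset.sum_congr rfl fun i _ => Finset.sum_congr rfl fun j _ => ?_
    split_ifs <;> simp
  rw [this]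
  exact Submodule.sum_mem _ fun i _ => Submodule.sum_mem _ fun j _ =>
    Submodule.smul_mem _ _ (form_mem_quadratic i j)

/-- The relations `≃` are definable in `(V, +, 0, R)`. -/
theorem orderDefinable [NeZero p] (halt : β.IsAlt) (hsep : IsSeparatedSystem β) :
    OrderDefinable β := by
  rintro n (_ | A) (_ | A')
  · exact (IsBaseDefinable.const True).congr fun x => iff_of_true trivial rfl
  · exact (IsBaseDefinable.const False).congr fun x =>
      iff_of_false not_false (Option.some_ne_none _).symm
  · exact (IsBaseDefinable.const False).congr fun x =>
      iff_of_false not_false (Option.some_ne_none _)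
  · exact (isBaseDefinable_eq_of_mem_quadratic halt hsep
      (comp_mem_quadratic (Sum.inl : Fin n → Fin n ⊕ Fin n) (skewSum_mem_quadratic A))
      (comp_mem_quadratic (Sum.inr : Fin n → Fin n ⊕ Fin n) (skewSum_mem_quadratic A'))).congr
      fun x => Option.some_inj.symm

end BaseDefinability

/-! ### Types coded by tuples of vectors -/

section Coded

variable {p : ℕ} {V W : Type u} [AddCommGroup V] [Module (ZMod p) V]
  [AddCommGroup W] [Module (ZMod p) W]

/-- A type interpreted without parameters in `(V, +, 0, R)`: it is covered by finitely many charts,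
defined on finite powers of `V`, and equality of values of charts is definable. The imaginary sorts
are of this form, and so are finite products of such types. -/
class Coded (β : V →ₗ[ZMod p] V →ₗ[ZMod p] W) (A : Type v) where
  /-- The index set of the charts. -/
  Chart : Type
  finite_chart : Finite Chart
  /-- The chart `i` is defined on the power `V^(dim i)`. -/
  dim : Chart → Type
  finite_dim : ∀ i, Finite (dim i)
  /-- The charts. -/
  decode : ∀ i, (dim i → V) → A
  surj : ∀ a, ∃ i x, decode i x = a
  isBaseDefinable_eq : ∀ i j, IsBaseDefinable β
    {z : dim i ⊕ dim j → V | decode i (z ∘ Sum.inl) = decode j (z ∘ Sum.inr)}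

attribute [instance] Coded.finite_chart Coded.finite_dim

variable (β : V →ₗ[ZMod p] V →ₗ[ZMod p] W) {A : Type*} {B : Type*} {C : Type*}
  [Coded β A] [Coded β B] [Coded β C]

/-- The subset `D` of the coded type `A` is definable without parameters. -/
def DSet (D : Set A) : Prop :=
  ∀ i : Coded.Chart β A, IsBaseDefinable β {x | Coded.decode i x ∈ D}

instance : Coded β V where
  Chart := Unit
  finite_chart := inferInstance
  dim _ := Unit
  finite_dim _ := inferInstance
  decode _ x := x ()
  surj a := ⟨(), fun _ => a, rfl⟩
  isBaseDefinable_eq _ _ := (IsBaseTerm.var _).isBaseDefinable_eq (IsBaseTerm.var _)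

instance : Coded β PUnit.{v + 1} where
  Chart := Unit
  finite_chart := inferInstance
  dim _ := Empty
  finite_dim _ := inferInstance
  decode _ _ := PUnit.unit
  surj _ := ⟨(), Empty.elim, rfl⟩
  isBaseDefinable_eq _ _ := (IsBaseDefinable.const True).congr fun _ => iff_of_true trivial rfl

instance (E : ImagSort β) : Coded β (Quotient E.rel) where
  Chart := E.ι
  finite_chart := E.finite
  dim i := Fin (E.n i)
  finite_dim _ := inferInstance
  decode i x := Quotient.mk E.rel ⟨i, x⟩
  surj a := by
    obtain ⟨⟨i, x⟩, rfl⟩ := Quotient.exists_rep a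
    exact ⟨i, x, rfl⟩
  isBaseDefinable_eq i j := (E.definable i j).congr fun _ => Quotient.eq.symm

instance Coded.prod : Coded β (A × B) where
  Chart := Coded.Chart β A × Coded.Chart β B
  finite_chart := inferInstance
  dim i := Coded.dim i.1 ⊕ Coded.dim i.2
  finite_dim _ := inferInstance
  decode i x := (Coded.decode i.1 (x ∘ Sum.inl), Coded.decode i.2 (x ∘ Sum.inr))
  surj a := by
    obtain ⟨i, x, hx⟩ := Coded.surj (β := β) a.1
    obtain ⟨j, y, hy⟩ := Coded.surj (β := β) a.2
    exact ⟨(i, j), Sum.elim x y, Prod.ext hx hy⟩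
  isBaseDefinable_eq i j :=
    (((Coded.isBaseDefinable_eq i.1 j.1).comp (Sum.map Sum.inl Sum.inl)).inter
      ((Coded.isBaseDefinable_eq i.2 j.2).comp (Sum.map Sum.inr Sum.inr))).congr
      fun _ => ⟨fun h => Prod.ext h.1 h.2, fun h => ⟨congrArg Prod.fst h, congrArg Prod.snd h⟩⟩

instance Coded.pi {κ : Type} [Finite κ] {F : κ → Type*} [∀ k, Coded β (F k)] :
    Coded β (∀ k, F k) where
  Chart := ∀ k, Coded.Chart β (F k)
  finite_chart := inferInstance
  dim i := Σ k, Coded.dim (i k)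
  finite_dim _ := inferInstance
  decode i x k := Coded.decode (i k) fun t => x ⟨k, t⟩
  surj a := by
    choose i x hx using fun k => Coded.surj (β := β) (a k)
    exact ⟨i, fun t => x t.1 t.2, funext hx⟩
  isBaseDefinable_eq i j := by
    refine (IsBaseDefinable.iInter fun k => (Coded.isBaseDefinable_eq (i k) (j k)).comp
      (Sum.map (fun t => (⟨k, t⟩ : Σ k, Coded.dim (i k)))
        fun t => (⟨k, t⟩ : Σ k, Coded.dim (j k)))).congr fun x => ?_
    rw [Set.mem_iInter]
    exact funext_iff.symm

variable {β}

namespace DSet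

theorem congr {X Y : Set A} (hX : DSet β X) (h : ∀ x, x ∈ X ↔ x ∈ Y) : DSet β Y :=
  Set.ext h ▸ hX

theorem compl {X : Set A} (hX : DSet β X) : DSet β Xᶜ := fun i => (hX i).compl

theorem inter {X Y : Set A} (hX : DSet β X) (hY : DSet β Y) : DSet β (X ∩ Y) :=
  fun i => (hX i).inter (hY i)

theorem union {X Y : Set A} (hX : DSet β X) (hY : DSet β Y) : DSet β (X ∪ Y) :=
  fun i => (hX i).union (hY i)

theorem iInter {ι : Type*} [Finite ι] {X : ι → Set A} (hX : ∀ i, DSet β (X i)) :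
    DSet β (⋂ i, X i) := fun i =>
  (IsBaseDefinable.iInter fun k => hX k i).congr fun x => by
    simp only [Set.mem_iInter, Set.mem_ofPred_eq]

theorem const (P : Prop) : DSet β {_x : A | P} := fun _ => IsBaseDefinable.const P

theorem exists_snd {D : Set (A × B)} (hD : DSet β D) : DSet β {a | ∃ b, (a, b) ∈ D} := by
  intro i
  refine (IsBaseDefinable.iUnion fun j => (hD (i, j)).exists_sum).congr fun x => ?_
  simp only [Set.mem_iUnion, Set.mem_ofPred_eq]
  constructor
  · rintro ⟨j, y, h⟩
    exact ⟨_, h⟩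
  · rintro ⟨b, h⟩
    obtain ⟨j, y, rfl⟩ := Coded.surj (β := β) b
    exact ⟨j, y, h⟩

end DSet

variable (β) in
/-- The graph of the map `f` between coded types is definable without parameters. -/
def DMap (f : A → B) : Prop := DSet β {q : A × B | f q.1 = q.2}

namespace DMap

theorem preimage {f : A → B} (hf : DMap β f) {D : Set B} (hD : DSet β D) :
    DSet β {a | f a ∈ D} := by
  have hD' : DSet β {q : A × B | q.2 ∈ D} := fun i => (hD i.2).comp Sum.inr
  refine (DSet.exists_snd (hf.inter hD')).congr fun a => ⟨?_, fun h => ⟨f a, rfl, h⟩⟩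
  rintro ⟨b, hb, h⟩
  change f a = b at hb
  exact (hb ▸ h : f a ∈ D)

theorem comp {g : B → C} {f : A → B} (hg : DMap β g) (hf : DMap β f) :
    DMap β fun a => g (f a) := by
  have h1 : DSet β {q : (A × C) × B | f q.1.1 = q.2} := fun i =>
    (hf (i.1.1, i.2)).comp (Sum.elim (Sum.inl ∘ Sum.inl) Sum.inr)
  have h2 : DSet β {q : (A × C) × B | g q.2 = q.1.2} := fun i =>
    (hg (i.2, i.1.2)).comp (Sum.elim Sum.inr (Sum.inl ∘ Sum.inr))
  refine (DSet.exists_snd (h1.inter h2)).congr fun q => ⟨?_, fun h => ⟨f q.1, rfl, h⟩⟩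
  rintro ⟨b, hb, h⟩
  change f q.1 = b at hb
  change g b = q.2 at h
  change g (f q.1) = q.2
  rw [hb, h]

theorem id : DMap β fun a : A => a := fun i => Coded.isBaseDefinable_eq i.1 i.2

theorem fst : DMap β fun q : A × B => q.1 := fun i =>
  (Coded.isBaseDefinable_eq i.1.1 i.2).comp (Sum.elim (Sum.inl ∘ Sum.inl) Sum.inr)

theorem snd : DMap β fun q : A × B => q.2 := fun i =>
  (Coded.isBaseDefinable_eq i.1.2 i.2).comp (Sum.elim (Sum.inl ∘ Sum.inr) Sum.inr)

theorem prodMk {f : A → B} {g : A → C} (hf : DMap β f) (hg : DMap β g) :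
    DMap β fun a => (f a, g a) := by
  have h1 : DSet β {q : A × (B × C) | f q.1 = q.2.1} := fun i =>
    (hf (i.1, i.2.1)).comp (Sum.elim Sum.inl (Sum.inr ∘ Sum.inl))
  have h2 : DSet β {q : A × (B × C) | g q.1 = q.2.2} := fun i =>
    (hg (i.1, i.2.2)).comp (Sum.elim Sum.inl (Sum.inr ∘ Sum.inr))
  exact (h1.inter h2).congr fun q =>
    ⟨fun h => Prod.ext h.1 h.2, fun h => ⟨congrArg Prod.fst h, congrArg Prod.snd h⟩⟩

theorem const {b : B} (hb : DSet β {b}) : DMap β fun _ : A => b := fun i =>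
  ((hb i.2).comp Sum.inr).congr fun _ => eq_comm

variable {κ : Type} [Finite κ] {F : κ → Type*} [∀ k, Coded β (F k)]

theorem pi {f : ∀ k, A → F k} (hf : ∀ k, DMap β (f k)) : DMap β fun a k => f k a := by
  have h (k : κ) : DSet β {q : A × (∀ k, F k) | f k q.1 = q.2 k} := fun i =>
    (hf k (i.1, i.2 k)).comp (Sum.map _root_.id fun t => (⟨k, t⟩ : Σ k, Coded.dim (i.2 k)))
  refine (DSet.iInter h).congr fun q => ?_
  rw [Set.mem_iInter]
  exact funext_iff.symm

theorem eval (k : κ) : DMap β fun a : ∀ k, F k => a k := fun i =>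
  (Coded.isBaseDefinable_eq (i.1 k) i.2).comp
    (Sum.map (fun t => (⟨k, t⟩ : Σ k, Coded.dim (i.1 k))) _root_.id)

end DMap

/-- A set of tuples of vectors is a definable set in the sense of coded types if and only if it is
definable in `(V, +, 0, R)`. -/
theorem dSet_iff_isBaseDefinable {α : Type} [Finite α] {D : Set (α → V)} :
    DSet β D ↔ IsBaseDefinable β D := by
  refine ⟨fun h => ?_, fun h i => h.comp fun a => (⟨a, ()⟩ : Σ _ : α, Unit)⟩
  exact (h fun _ => ()).comp (Sigma.fst : (Σ _ : α, Unit) → α)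

end Coded

/-! ### The values of skew-symmetric sums -/

section Order

variable {p : ℕ} {V W : Type u} [AddCommGroup V] [Module (ZMod p) V]
  [AddCommGroup W] [Module (ZMod p) W] {β : V →ₗ[ZMod p] V →ₗ[ZMod p] W}

variable (β) in
/-- The set of elements of `W` of order at most `n`, i.e. of the form `∑_{i<j} a_{ij} β(v_i, v_j)`
with `v` of length `n`. -/
def orderRange (n : ℕ) : Set W := {w | ∃ y : SkewMatrix p n × (Fin n → V), skewSum β y.1 y.2 = w}

theorem skewSum_eq_pairSum {n : ℕ} (A : SkewMatrix p n) (x : Fin n → V) :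
    skewSum β A x = pairSum β x (Matrix.of fun i j => if i < j then A.1 i j else 0) := by
  simp [skewSum, pairSum_apply]

theorem mem_orderRange_iff (halt : β.IsAlt) {n : ℕ} {w : W} :
    w ∈ orderRange β n ↔ ∃ (M : Matrix (Fin n) (Fin n) (ZMod p)) (x : Fin n → V),
      pairSum β x M = w := by
  constructor
  · rintro ⟨⟨A, x⟩, rfl⟩
    exact ⟨_, x, (skewSum_eq_pairSum A x).symm⟩
  · rintro ⟨M, x, rfl⟩
    refine ⟨(⟨M - M.transpose, by simp⟩, x), ?_⟩
    rw [pairSum_apply, sum_sum_eq_diag_add_lt]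
    simp only [halt.self_eq_zero, smul_zero, Finset.sum_const_zero, zero_add]
    refine Finset.sum_congr rfl fun i _ => Finset.sum_congr rfl fun j _ => ?_
    rw [← halt.neg (x i) (x j), smul_neg, ← sub_eq_add_neg, ← sub_smul]
    rfl

theorem zero_mem_orderRange (halt : β.IsAlt) (n : ℕ) : (0 : W) ∈ orderRange β n :=
  (mem_orderRange_iff halt).2 ⟨0, 0, map_zero _⟩

theorem smul_mem_orderRange (halt : β.IsAlt) {n : ℕ} {w : W} (hw : w ∈ orderRange β n)
    (c : ZMod p) : c • w ∈ orderRange β n := by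
  obtain ⟨M, x, rfl⟩ := (mem_orderRange_iff halt).1 hw
  exact (mem_orderRange_iff halt).2 ⟨c • M, x, map_smul _ _ _⟩

theorem neg_mem_orderRange (halt : β.IsAlt) {n : ℕ} {w : W} (hw : w ∈ orderRange β n) :
    -w ∈ orderRange β n := by
  simpa using smul_mem_orderRange halt hw (-1)

theorem add_mem_orderRange (halt : β.IsAlt) {n m : ℕ} {w w' : W} (hw : w ∈ orderRange β n)
    (hw' : w' ∈ orderRange β m) : w + w' ∈ orderRange β (n + m) := by
  obtain ⟨M, x, rfl⟩ := (mem_orderRange_iff halt).1 hw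
  obtain ⟨N, y, rfl⟩ := (mem_orderRange_iff halt).1 hw'
  refine (mem_orderRange_iff halt).2 ⟨(Matrix.fromBlocks M 0 0 N).submatrix finSumFinEquiv.symm
    finSumFinEquiv.symm, Sum.elim x y ∘ finSumFinEquiv.symm, ?_⟩
  simp only [pairSum_apply, Matrix.submatrix_apply, Function.comp_apply]
  rw [Equiv.sum_comp finSumFinEquiv.symm fun i => ∑ j, Matrix.fromBlocks M 0 0 N i
    (finSumFinEquiv.symm j) • β (Sum.elim x y i) (Sum.elim x y (finSumFinEquiv.symm j))]
  simp_rw [fun i => Equiv.sum_comp finSumFinEquiv.symm fun j => Matrix.fromBlocks M 0 0 N i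
    j • β (Sum.elim x y i) (Sum.elim x y j)]
  simp [Fintype.sum_sum_type]

theorem orderRange_mono (halt : β.IsAlt) {n m : ℕ} (h : n ≤ m) :
    orderRange β n ⊆ orderRange β m := by
  intro w hw
  obtain ⟨k, rfl⟩ := Nat.exists_eq_add_of_le h
  simpa using add_mem_orderRange halt hw (zero_mem_orderRange halt k)

theorem orderRange_zero : orderRange β 0 = {0} := by
  ext w
  constructor
  · rintro ⟨y, rfl⟩
    simp [skewSum]
  · rintro rfl
    exact ⟨(⟨0, by simp⟩, 0), by simp [skewSum]⟩

theorem form_mem_orderRange (halt : β.IsAlt) (v v' : V) : β v v' ∈ orderRange β 2 := by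
  refine (mem_orderRange_iff halt).2 ⟨Matrix.of ![![0, 1], ![0, 0]], ![v, v'], ?_⟩
  simp [pairSum_apply, Fin.sum_univ_two]

variable (β) in
/-- The span of the image of `β`. -/
def orderSpan (halt : β.IsAlt) : AddSubgroup W where
  carrier := {w | ∃ n, w ∈ orderRange β n}
  zero_mem' := ⟨0, zero_mem_orderRange halt 0⟩
  add_mem' := fun ⟨_, h⟩ ⟨_, h'⟩ => ⟨_, add_mem_orderRange halt h h'⟩
  neg_mem' := fun ⟨_, h⟩ => ⟨_, neg_mem_orderRange halt h⟩

/-- If finitely many translates of the set of elements of order at most `N` cover `W`, then the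
order of the elements of the span of the image of `β` is bounded. -/
theorem exists_orderRange_eq_orderSpan (halt : β.IsAlt) {ι : Type*} [Finite ι] {N : ℕ} {r : ι → W}
    (h : ∀ w, ∃ i, w + r i ∈ orderRange β N) :
    ∃ N', N ≤ N' ∧ ∀ w, w ∈ orderSpan β halt ↔ w ∈ orderRange β N' := by
  classical
  have := Fintype.ofFinite ι
  have hn : ∀ i, ∃ n, r i ∈ orderSpan β halt → r i ∈ orderRange β n := by
    intro i
    by_cases hi : r i ∈ orderSpan β halt
    · obtain ⟨n, hn⟩ := hi
      exact ⟨n, fun _ => hn⟩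
    · exact ⟨0, fun h => absurd h hi⟩
  choose n hn using hn
  refine ⟨N + ∑ i, n i, Nat.le_add_right _ _, fun w => ⟨fun hw => ?_, fun hw => ⟨_, hw⟩⟩⟩
  obtain ⟨i, hi⟩ := h w
  have hr : r i ∈ orderSpan β halt := by
    have h1 : w + r i ∈ orderSpan β halt := ⟨_, hi⟩
    simpa using (orderSpan β halt).sub_mem h1 hw
  have h2 := add_mem_orderRange halt hi (neg_mem_orderRange halt
    (orderRange_mono halt (Finset.single_le_sum (fun _ _ => Nat.zero_le _) (Finset.mem_univ i))
      (hn i hr)))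
  simpa using h2

/-! ### The sorts `Bₙ` as sets of values -/

variable [NeZero p] (h : OrderDefinable β)

instance (E : ImagSort β) : Coded β (expCarrier β (.imag E)) :=
  inferInstanceAs (Coded β (Quotient E.rel))

/-- The sort `Bₙ` of the expansion. -/
abbrev OrdSort (n : ℕ) : Type u := expCarrier β (.imag (orderSort β h n))

/-- The element of `W` coded by an element of `Bₙ`, if any. -/
def orderVal (n : ℕ) : OrdSort h n → Option W :=
  Quotient.lift (s := orderSetoid β n) (orderValue β n) fun _ _ hab => hab

/-- The map `fₙ`, with values in the sort `Bₙ` of the expansion. -/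
noncomputable def orderFun (n : ℕ) (w : W) : OrdSort h n := orderMap β n w

theorem orderVal_injective (n : ℕ) : Function.Injective (orderVal h n) := by
  intro a b
  induction a using Quotient.inductionOn
  induction b using Quotient.inductionOn
  exact fun hab => Quotient.sound hab

variable {h}

theorem orderVal_orderFun {n : ℕ} {w : W} (hw : w ∈ orderRange β n) :
    orderVal h n (orderFun h n w) = some w := by
  obtain ⟨⟨A, x⟩, rfl⟩ := hw
  rw [orderFun, orderMap_skewSum]
  rfl

theorem orderVal_orderFun_of_notMem {n : ℕ} {w : W} (hw : w ∉ orderRange β n) :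
    orderVal h n (orderFun h n w) = none := by
  have : orderFun h n w = Quotient.mk (orderSetoid β n) ⟨none, fun i => i.elim0⟩ := dif_neg hw
  rw [this]
  rfl

theorem orderVal_orderFun_eq_some {n : ℕ} {w w' : W} :
    orderVal h n (orderFun h n w) = some w' ↔ w ∈ orderRange β n ∧ w = w' := by
  by_cases hw : w ∈ orderRange β n
  · simp [orderVal_orderFun hw, hw]
  · simp [orderVal_orderFun_of_notMem hw, hw]

theorem mem_orderRange_of_orderVal {n : ℕ} {b : OrdSort h n} {w : W}
    (hb : orderVal h n b = some w) : w ∈ orderRange β n := by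
  induction b using Quotient.inductionOn with | _ b
  obtain ⟨_ | A, x⟩ := b
  · exact absurd hb.symm (Option.some_ne_none _)
  · exact ⟨(A, x), Option.some_injective _ hb⟩

theorem orderFun_of_orderVal {n : ℕ} {b : OrdSort h n} {w : W}
    (hb : orderVal h n b = some w) : orderFun h n w = b :=
  orderVal_injective h n (by rw [hb, orderVal_orderFun (mem_orderRange_of_orderVal hb)])

variable (h) in
/-- The point `u` of `Bₙ`. -/
def orderNone (n : ℕ) : OrdSort h n := Quotient.mk (orderSetoid β n) ⟨none, fun i => i.elim0⟩

theorem orderVal_orderNone (n : ℕ) : orderVal h n (orderNone h n) = none := rfl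

theorem orderFun_of_notMem {n : ℕ} {w : W} (hw : w ∉ orderRange β n) :
    orderFun h n w = orderNone h n :=
  orderVal_injective h n (orderVal_orderFun_of_notMem hw)

theorem orderFun_eq_orderNone_iff {n : ℕ} {w : W} :
    orderFun h n w = orderNone h n ↔ w ∉ orderRange β n := by
  refine ⟨fun hn hw => ?_, orderFun_of_notMem⟩
  have := congrArg (orderVal h n) hn
  rw [orderVal_orderFun hw] at this
  exact Option.some_ne_none _ this

theorem exists_orderFun_eq {n : ℕ} {b : OrdSort h n} (hb : b ≠ orderNone h n) :
    ∃ w ∈ orderRange β n, orderFun h n w = b := by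
  cases hw : orderVal h n b with
  | none => exact absurd (orderVal_injective h n hw) hb
  | some w => exact ⟨w, mem_orderRange_of_orderVal hw, orderFun_of_orderVal hw⟩

variable (h) in
/-- The extension of `fₙ` by `u ↦ u`. -/
noncomputable def orderLift (n : ℕ) : Option W → OrdSort h n
  | none => orderNone h n
  | some w => orderFun h n w

/-- A partial map from a coded type to `W` which in each chart is either nowhere defined or
quadratic. -/
def IsChartQuadratic (β : V →ₗ[ZMod p] V →ₗ[ZMod p] W) {A : Type*} [Coded β A]
    (F : A → Option W) : Prop :=
  ∀ i : Coded.Chart β A, (∀ x, F (Coded.decode i x) = none) ∨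
    ∃ q ∈ quadratic β (Coded.dim i), ∀ x, F (Coded.decode i x) = some (q x)

theorem isChartQuadratic_orderVal (n : ℕ) : IsChartQuadratic β (orderVal h n) := by
  rintro (_ | A)
  · exact .inl fun _ => rfl
  · exact .inr ⟨_, skewSum_mem_quadratic A, fun _ => rfl⟩

section

variable {A B : Type*} [Coded β A] [Coded β B]

omit [NeZero p] in
theorem IsChartQuadratic.map₂ {F : A → Option W} {G : B → Option W}
    (hF : IsChartQuadratic β F) (hG : IsChartQuadratic β G) (c d : ZMod p) :
    IsChartQuadratic β fun q : A × B =>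
      Option.map₂ (fun w w' => c • w + d • w') (F q.1) (G q.2) := by
  rintro ⟨i, j⟩
  rcases hF i with hi | ⟨q, hq, hi⟩
  · exact .inl fun x => by simp [Coded.decode, hi]
  rcases hG j with hj | ⟨r, hr, hj⟩
  · exact .inl fun x => by simp [Coded.decode, hj]
  · refine .inr ⟨_, Submodule.add_mem _ (Submodule.smul_mem _ c (comp_mem_quadratic Sum.inl hq))
      (Submodule.smul_mem _ d (comp_mem_quadratic Sum.inr hr)), fun x => ?_⟩
    simp only [Coded.decode, hi, hj]
    rfl

/-- Coincidence of values of chartwise quadratic maps is a definable condition, since the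
vanishing of a quadratic expression is. -/
theorem IsChartQuadratic.dSet_eq (halt : β.IsAlt) (hsep : IsSeparatedSystem β)
    {F : A → Option W} {G : B → Option W}
    (hF : IsChartQuadratic β F) (hG : IsChartQuadratic β G) :
    DSet β {q : A × B | F q.1 = G q.2} := by
  rintro ⟨i, j⟩
  rcases hF i with hi | ⟨q, hq, hi⟩ <;> rcases hG j with hj | ⟨r, hr, hj⟩
  · exact (IsBaseDefinable.const True).congr fun x => by simp [Coded.decode, hi, hj]
  · exact (IsBaseDefinable.const False).congr fun x => by simp [Coded.decode, hi, hj]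
  · exact (IsBaseDefinable.const False).congr fun x => by simp [Coded.decode, hi, hj]
  · exact (isBaseDefinable_eq_of_mem_quadratic halt hsep (comp_mem_quadratic Sum.inl hq)
      (comp_mem_quadratic Sum.inr hr)).congr fun x => by
        simp only [Coded.decode, Set.mem_ofPred_eq, hi, hj, Option.some_inj]
        rfl

theorem dSet_orderNone (n : ℕ) : DSet β {orderNone h n} := by
  rintro (_ | A)
  · exact (IsBaseDefinable.const True).congr fun x => iff_of_true trivial
      (orderVal_injective h n rfl)
  · refine (IsBaseDefinable.const False).congr fun x => iff_of_false not_false fun hx => ?_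
    exact Option.some_ne_none _ (congrArg (orderVal h n) (Set.mem_singleton_iff.1 hx))

/-- The value of a chartwise quadratic map, seen in `Bₙ`, is a definable map. -/
theorem IsChartQuadratic.dMap_orderLift (halt : β.IsAlt) (hsep : IsSeparatedSystem β)
    {F : A → Option W} (hF : IsChartQuadratic β F) (n : ℕ) :
    DMap β fun a => orderLift h n (F a) := by
  have hn : DSet β {q : A × OrdSort h n | q.2 = orderNone h n} :=
    DMap.snd.preimage (dSet_orderNone n)
  have h1 := (hF.dSet_eq halt hsep (isChartQuadratic_orderVal (h := h) n)).inter hn.compl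
  have h2 : DSet β {q : A × OrdSort h n | ¬∃ b, F q.1 = orderVal h n b ∧ b ≠ orderNone h n} :=
    DMap.fst.preimage h1.exists_snd.compl
  refine (h1.union (h2.inter hn)).congr fun q => ?_
  have key : ∀ b, b ≠ orderNone h n → (F q.1 = orderVal h n b ↔ orderLift h n (F q.1) = b) := by
    intro b hb
    constructor
    · intro hq
      cases hw : orderVal h n b with
      | none => exact absurd (orderVal_injective h n hw) hb
      | some w => rw [hq, hw]; exact orderFun_of_orderVal hw
    · rintro rfl
      cases hw : F q.1 with
      | none => rw [hw] at hb; exact absurd rfl hb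
      | some w =>
        by_cases hr : w ∈ orderRange β n
        · exact (orderVal_orderFun hr).symm
        · rw [hw] at hb; exact absurd (orderFun_of_notMem hr) hb
  change (F q.1 = orderVal h n q.2 ∧ q.2 ≠ orderNone h n) ∨
    ((¬∃ b, F q.1 = orderVal h n b ∧ b ≠ orderNone h n) ∧ q.2 = orderNone h n) ↔
      orderLift h n (F q.1) = q.2
  constructor
  · rintro (⟨h3, h4⟩ | ⟨h3, h4⟩)
    · exact (key _ h4).1 h3
    · rw [h4]
      by_contra h5
      exact h3 ⟨_, (key _ h5).2 rfl, h5⟩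
  · intro h3
    by_cases h4 : q.2 = orderNone h n
    · refine .inr ⟨?_, h4⟩
      rintro ⟨b, h5, h6⟩
      exact h6 (((key b h6).1 h5).symm.trans (h3.trans h4))
    · exact .inl ⟨(key _ h4).2 h3, h4⟩

end

/-- `f_N(c w + r)` is a definable function of `fₙ(w)` and `f_{N+n}(r)` when `w` has order at
most `n`: if `c w + r` has order at most `N`, then `r` has order at most `N + n`. -/
theorem orderLift_map₂ (halt : β.IsAlt) {n N : ℕ} {w r : W} (hw : w ∈ orderRange β n)
    (c : ZMod p) :
    orderLift h N (Option.map₂ (fun w w' => c • w + (1 : ZMod p) • w')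
      (orderVal h n (orderFun h n w)) (orderVal h (N + n) (orderFun h (N + n) r))) =
      orderFun h N (c • w + r) := by
  rw [orderVal_orderFun hw]
  by_cases hr : r ∈ orderRange β (N + n)
  · rw [orderVal_orderFun hr]
    simp [orderLift]
  · rw [orderVal_orderFun_of_notMem hr, orderFun_of_notMem]
    · rfl
    · intro h1
      refine hr ?_
      simpa using add_mem_orderRange halt h1
        (neg_mem_orderRange halt (smul_mem_orderRange halt hw c))

/-- `fₙ(w)` is a function of `f_N(w)` for `n ≤ N`. -/
theorem orderLift_orderVal (halt : β.IsAlt) {n N : ℕ} (hn : n ≤ N) (w : W) :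
    orderLift h n (orderVal h N (orderFun h N w)) = orderFun h n w := by
  by_cases hw : w ∈ orderRange β N
  · rw [orderVal_orderFun hw]; rfl
  · rw [orderVal_orderFun_of_notMem hw,
      orderFun_of_notMem fun h1 => hw (orderRange_mono halt hn h1)]
    rfl

end Order

/-! ### Substitution and definable sets in many-sorted logic -/

section ManySorted

variable {S : Type v} {L : MSLanguage.{v, w} S}

/-- Substitution of terms for the variables of a term. -/
def MSTerm.subst {ι κ : Type} {σ : ι → S} {τ : κ → S} (f : ∀ i, MSTerm L τ (σ i)) :
    {s : S} → MSTerm L σ s → MSTerm L τ s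
  | _, .var i => f i
  | _, .func g ts => .func g fun i => (ts i).subst f

/-- Extension of a substitution by the identity on a new variable. -/
def MSTerm.extendSubst {ι κ : Type} {σ : ι → S} {τ : κ → S} (s : S)
    (f : ∀ i, MSTerm L τ (σ i)) :
    ∀ i, MSTerm L (extendContext s τ) (extendContext s σ i)
  | none => .var (σ := extendContext s τ) none
  | some i => (f i).subst fun j => .var (σ := extendContext s τ) (some j)

/-- Substitution of terms for the free variables of a formula. -/
def MSFormula.subst : {ι κ : Type} → {σ : ι → S} → {τ : κ → S} → (∀ i, MSTerm L τ (σ i)) →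
    MSFormula L σ → MSFormula L τ
  | _, _, _, _, _, .falsum => .falsum
  | _, _, _, _, f, .equal t t' => .equal (t.subst f) (t'.subst f)
  | _, _, _, _, f, .rel r ts => .rel r fun i => (ts i).subst f
  | _, _, _, _, f, .imp φ ψ => .imp (φ.subst f) (ψ.subst f)
  | _, _, _, _, f, .all s φ => .all s (φ.subst (MSTerm.extendSubst s f))

variable (M : MSStructure.{u} L) (T : Set S)

theorem MSTerm.eval_subst {ι κ : Type} {σ : ι → S} {τ : κ → S} (f : ∀ i, MSTerm L τ (σ i))
    (ρ : ∀ j, M.carrier (τ j)) {s : S} (t : MSTerm L σ s) :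
    (t.subst f).eval M ρ = t.eval M fun i => (f i).eval M ρ := by
  induction t with
  | var i => rfl
  | func g ts ih => exact congrArg (M.funMap g) (funext ih)

theorem MSTerm.isOver_subst {ι κ : Type} {σ : ι → S} {τ : κ → S} (f : ∀ i, MSTerm L τ (σ i))
    (hf : ∀ i, (f i).IsOver T) {s : S} (t : MSTerm L σ s) (ht : t.IsOver T) :
    (t.subst f).IsOver T := by
  induction t with
  | var i => exact hf i
  | func g ts ih => exact ⟨ht.1, fun i => ih i (ht.2 i)⟩

theorem MSFormula.realize_subst {ι κ : Type} {σ : ι → S} {τ : κ → S}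
    (f : ∀ i, MSTerm L τ (σ i)) (φ : MSFormula L σ) (ρ : ∀ j, M.carrier (τ j)) :
    (φ.subst f).Realize M ρ ↔ φ.Realize M fun i => (f i).eval M ρ := by
  induction φ generalizing κ τ with
  | falsum => exact Iff.rfl
  | equal t t' => simp only [subst, Realize, MSTerm.eval_subst]
  | rel r ts => simp only [subst, Realize, MSTerm.eval_subst]
  | imp φ ψ ih1 ih2 => simp only [subst, Realize, ih1, ih2]
  | all s φ ih =>
    simp only [subst, Realize, ih]
    refine forall_congr' fun a => iff_of_eq (congrArg _ (funext fun i => ?_))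
    cases i with
    | none => rfl
    | some i => exact MSTerm.eval_subst M _ _ _

theorem MSFormula.isOver_subst {ι κ : Type} {σ : ι → S} {τ : κ → S}
    (f : ∀ i, MSTerm L τ (σ i)) (hf : ∀ i, (f i).IsOver T) (φ : MSFormula L σ)
    (hφ : φ.IsOver T) : (φ.subst f).IsOver T := by
  induction φ generalizing κ τ with
  | falsum => trivial
  | equal t t' => exact ⟨t.isOver_subst T f hf hφ.1, t'.isOver_subst T f hf hφ.2⟩
  | rel r ts => exact fun i => (ts i).isOver_subst T f hf (hφ i)
  | imp φ ψ ih1 ih2 => exact ⟨ih1 f hf hφ.1, ih2 f hf hφ.2⟩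
  | all s φ ih =>
    refine ⟨hφ.1, ih _ (fun i => ?_) hφ.2⟩
    cases i with
    | none => exact hφ.1
    | some i =>
      -- weakening preserves the sorts of the subterms, whatever the sorts of the other variables
      have : ∀ {s' : S} (t : MSTerm L τ s'), t.IsOver T →
          (t.subst fun j => .var (σ := extendContext s τ) (some j)).IsOver T := by
        intro s' t ht
        induction t with
        | var j => exact ht
        | func g ts ih => exact ⟨ht.1, fun i => ih i (ht.2 i)⟩
      exact this _ (hf i)

/-- Definability without parameters by a formula which lives in the sorts of `T`. -/
def MSDefinable {ι : Type} (σ : ι → S) (X : Set (∀ i, M.carrier (σ i))) : Prop :=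
  ∃ φ : MSFormula L σ, φ.IsOver T ∧ X = {ρ | φ.Realize M ρ}

namespace MSDefinable

variable {M T} {ι : Type} {σ : ι → S} {X Y : Set (∀ i, M.carrier (σ i))}

theorem congr (hX : MSDefinable M T σ X) (h : ∀ x, x ∈ X ↔ x ∈ Y) : MSDefinable M T σ Y :=
  Set.ext h ▸ hX

theorem empty : MSDefinable M T σ ∅ := ⟨.falsum, trivial, rfl⟩

theorem imp (hX : MSDefinable M T σ X) (hY : MSDefinable M T σ Y) :
    MSDefinable M T σ {ρ | ρ ∈ X → ρ ∈ Y} := by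
  obtain ⟨φ, hφ, rfl⟩ := hX
  obtain ⟨ψ, hψ, rfl⟩ := hY
  exact ⟨.imp φ ψ, ⟨hφ, hψ⟩, rfl⟩

theorem compl (hX : MSDefinable M T σ X) : MSDefinable M T σ Xᶜ := hX.imp empty

theorem union (hX : MSDefinable M T σ X) (hY : MSDefinable M T σ Y) :
    MSDefinable M T σ (X ∪ Y) :=
  (hX.compl.imp hY).congr fun _ => or_iff_not_imp_left.symm

theorem inter (hX : MSDefinable M T σ X) (hY : MSDefinable M T σ Y) :
    MSDefinable M T σ (X ∩ Y) :=
  (hX.imp hY.compl).compl.congr fun _ => Classical.not_imp.trans (and_congr_right fun _ => not_not)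

theorem biUnion {κ : Type*} (s : Finset κ) {X : κ → Set (∀ i, M.carrier (σ i))}
    (hX : ∀ k, MSDefinable M T σ (X k)) : MSDefinable M T σ (⋃ k ∈ s, X k) := by
  classical
  induction s using Finset.induction_on with
  | empty => simpa using empty
  | insert a s _ ih => simpa only [Finset.set_biUnion_insert] using (hX a).union ih

theorem iUnion {κ : Type*} [Finite κ] {X : κ → Set (∀ i, M.carrier (σ i))}
    (hX : ∀ k, MSDefinable M T σ (X k)) : MSDefinable M T σ (⋃ k, X k) := by
  have := Fintype.ofFinite κ
  simpa using biUnion Finset.univ hX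

theorem iInter {κ : Type*} [Finite κ] {X : κ → Set (∀ i, M.carrier (σ i))}
    (hX : ∀ k, MSDefinable M T σ (X k)) : MSDefinable M T σ (⋂ k, X k) := by
  simpa using (iUnion fun k => (hX k).compl).compl

theorem forall_extend {s : S} (hs : s ∈ T) {X : Set (∀ i, M.carrier (extendContext s σ i))}
    (hX : MSDefinable M T (extendContext s σ) X) :
    MSDefinable M T σ {ρ | ∀ a : M.carrier s, extendAssignment a ρ ∈ X} := by
  obtain ⟨φ, hφ, rfl⟩ := hX
  exact ⟨.all s φ, ⟨hs, hφ⟩, rfl⟩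

theorem exists_extend {s : S} (hs : s ∈ T) {X : Set (∀ i, M.carrier (extendContext s σ i))}
    (hX : MSDefinable M T (extendContext s σ) X) :
    MSDefinable M T σ {ρ | ∃ a : M.carrier s, extendAssignment a ρ ∈ X} :=
  (hX.compl.forall_extend hs).compl.congr fun _ => not_forall_not

theorem subst {κ : Type} {τ : κ → S} (hX : MSDefinable M T σ X) (f : ∀ i, MSTerm L τ (σ i))
    (hf : ∀ i, (f i).IsOver T) :
    MSDefinable M T τ {ρ | (fun i => (f i).eval M ρ) ∈ X} := by
  obtain ⟨φ, hφ, rfl⟩ := hX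
  exact ⟨φ.subst f, φ.isOver_subst T f hf hφ, Set.ext fun ρ => (φ.realize_subst M f ρ).symm⟩

/-- A block of quantifiers over `s`: formulas only have single quantifiers, so the block is obtained
by induction on its length. -/
theorem exists_fin (hσ : ∀ i, σ i ∈ T) {s : S} (hs : s ∈ T) {n : ℕ}
    {X : Set (∀ z, M.carrier (Sum.elim σ (fun _ : Fin n => s) z))}
    (hX : MSDefinable M T (Sum.elim σ (fun _ : Fin n => s)) X) :
    MSDefinable M T σ {ρ | ∃ x : Fin n → M.carrier s, sumAssignment ρ x ∈ X} := by
  induction n with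
  | zero =>
    let f : ∀ z, MSTerm L σ (Sum.elim σ (fun _ : Fin 0 => s) z)
      | .inl i => .var i
      | .inr j => j.elim0
    refine (hX.subst f ?_).congr fun ρ => ?_
    · rintro (i | j)
      · exact hσ i
      · exact j.elim0
    · have : ∀ x : Fin 0 → M.carrier s,
          (fun z => (f z).eval M ρ) = sumAssignment (C := M.carrier) ρ x := by
        intro x
        funext z
        rcases z with i | j
        · rfl
        · exact j.elim0
      change (fun z => (f z).eval M ρ) ∈ X ↔ _
      constructor
      · intro h
        exact ⟨fun j => j.elim0, this (fun j => j.elim0) ▸ h⟩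
      · rintro ⟨x, h⟩
        rw [this x]
        exact h
  | succ n ih =>
    let τ : Option (ι ⊕ Fin n) → S := extendContext s (Sum.elim σ fun _ : Fin n => s)
    have hlast : ∀ j : Fin (n + 1), ∃ t : MSTerm L τ s, t.IsOver T ∧
        ∀ (ρ : ∀ i, M.carrier (σ i)) (x : Fin n → M.carrier s) (a : M.carrier s),
          t.eval M (extendAssignment a (sumAssignment (C := M.carrier) ρ x)) =
            Fin.snoc (α := fun _ => M.carrier s) x a j := by
      intro j
      refine Fin.lastCases ⟨.var (σ := τ) none, hs, fun ρ x a => ?_⟩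
        (fun k => ⟨.var (σ := τ) (some (.inr k)), hs, fun ρ x a => ?_⟩) j
      · rw [Fin.snoc_last]; rfl
      · rw [Fin.snoc_castSucc]; rfl
    choose t ht hlast using hlast
    let f : ∀ z, MSTerm L τ (Sum.elim σ (fun _ : Fin (n + 1) => s) z)
      | .inl i => .var (σ := τ) (some (.inl i))
      | .inr j => t j
    have hf : ∀ z, (f z).IsOver T := by
      rintro (i | j)
      · exact hσ i
      · exact ht j
    refine (ih ((hX.subst f hf).exists_extend hs)).congr fun ρ => ?_
    have key : ∀ (x : Fin n → M.carrier s) (a : M.carrier s),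
        (fun z => (f z).eval M (extendAssignment a (sumAssignment (C := M.carrier) ρ x))) =
          sumAssignment (C := M.carrier) (τ := fun _ : Fin (n + 1) => s) ρ
            (Fin.snoc (α := fun _ => M.carrier s) x a) := by
      intro x a
      funext z
      rcases z with i | j
      · rfl
      · exact hlast j ρ x a
    constructor
    · rintro ⟨x, a, h⟩
      change (fun z => (f z).eval M _) ∈ X at h
      exact ⟨_, key x a ▸ h⟩
    · rintro ⟨x, h⟩
      refine ⟨Fin.init (α := fun _ => M.carrier s) x, x (Fin.last n), ?_⟩
      change (fun z => (f z).eval M _) ∈ X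
      rw [key, Fin.snoc_init_self]
      exact h

theorem exists_tuple (hσ : ∀ i, σ i ∈ T) {s : S} (hs : s ∈ T) {γ : Type} [Finite γ]
    {X : Set (∀ z, M.carrier (Sum.elim σ (fun _ : γ => s) z))}
    (hX : MSDefinable M T (Sum.elim σ (fun _ : γ => s)) X) :
    MSDefinable M T σ {ρ | ∃ x : γ → M.carrier s, sumAssignment ρ x ∈ X} := by
  obtain ⟨n, ⟨e⟩⟩ := Finite.exists_equiv_fin γ
  let f : ∀ z, MSTerm L (Sum.elim σ (fun _ : Fin n => s)) (Sum.elim σ (fun _ : γ => s) z)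
    | .inl i => .var (σ := Sum.elim σ (fun _ : Fin n => s)) (.inl i)
    | .inr j => .var (σ := Sum.elim σ (fun _ : Fin n => s)) (.inr (e j))
  have hf : ∀ z, (f z).IsOver T := by
    rintro (i | j)
    · exact hσ i
    · exact hs
  refine (exists_fin hσ hs (hX.subst f hf)).congr fun ρ => ?_
  have key : ∀ x : Fin n → M.carrier s,
      (fun z => (f z).eval M (sumAssignment (C := M.carrier) ρ x)) =
        sumAssignment (C := M.carrier) (τ := fun _ : γ => s) ρ fun j => x (e j) := by
    intro x
    funext z
    rcases z with i | j <;> rfl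
  constructor
  · rintro ⟨x, h⟩
    change (fun z => (f z).eval M _) ∈ X at h
    exact ⟨_, key x ▸ h⟩
  · rintro ⟨x, h⟩
    refine ⟨fun j => x (e.symm j), ?_⟩
    change (fun z => (f z).eval M _) ∈ X
    rw [key]
    simpa using h

end MSDefinable

/-- The operations and the relation of a structure for the language of `(V, +, 0, R)` on the sort
`s` are given by terms and by a formula which live in the sorts of `T`. -/
structure ExtendsBase (M : MSStructure.{u} L) (T : Set S) (s : S)
    [baseLanguage.Structure (M.carrier s)] : Prop where
  mem : s ∈ T
  zero : ∀ {ι : Type} (σ : ι → S), ∃ t : MSTerm L σ s, t.IsOver T ∧ ∀ ρ, t.eval M ρ =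
    FirstOrder.Language.Structure.funMap (L := baseLanguage) (n := 0) BaseFunc.zero ![]
  add : ∀ {ι : Type} {σ : ι → S} (t t' : MSTerm L σ s), t.IsOver T → t'.IsOver T →
    ∃ t'' : MSTerm L σ s, t''.IsOver T ∧ ∀ ρ, t''.eval M ρ =
      FirstOrder.Language.Structure.funMap (L := baseLanguage) (n := 2) BaseFunc.add
        ![t.eval M ρ, t'.eval M ρ]
  rel : ∀ {ι : Type} {σ : ι → S} (t t' : MSTerm L σ s), t.IsOver T → t'.IsOver T →
    ∃ φ : MSFormula L σ, φ.IsOver T ∧ ∀ ρ, φ.Realize M ρ ↔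
      FirstOrder.Language.Structure.RelMap (L := baseLanguage) (n := 2) BaseRel.R
        ![t.eval M ρ, t'.eval M ρ]

namespace ExtendsBase

variable {M T} {s : S} [baseLanguage.Structure (M.carrier s)]

theorem exists_term (h : ExtendsBase M T s) {α : Type} (t : baseLanguage.Term α) :
    ∃ t' : MSTerm L (fun _ : α => s) s, t'.IsOver T ∧ ∀ ρ, t'.eval M ρ = t.realize ρ := by
  induction t with
  | var i => exact ⟨.var (σ := fun _ : α => s) i, h.mem, fun _ => rfl⟩
  | @func n f ts ih =>
    rcases f with _ | _
    · obtain ⟨t, ht, h1⟩ := h.zero fun _ : α => s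
      refine ⟨t, ht, fun ρ => (h1 ρ).trans (congrArg _ (funext fun i => i.elim0))⟩
    · choose t ht h1 using ih
      obtain ⟨t', ht', h2⟩ := h.add (t 0) (t 1) (ht 0) (ht 1)
      refine ⟨t', ht', fun ρ => (h2 ρ).trans (congrArg _ (funext fun i => ?_))⟩
      fin_cases i
      · exact h1 0 ρ
      · exact h1 1 ρ

/-- Translation of the one-sorted formulas in the language of `(V, +, 0, R)`. -/
theorem msDefinable_boundedFormula (h : ExtendsBase M T s) {α : Type} {n : ℕ}
    (φ : baseLanguage.BoundedFormula α n) :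
    MSDefinable M T (fun _ : α ⊕ Fin n => s)
      {z | φ.Realize (fun a => z (.inl a)) fun j => z (.inr j)} := by
  induction φ with
  | falsum => exact MSDefinable.empty
  | equal t₁ t₂ =>
    obtain ⟨t, ht, h1⟩ := h.exists_term t₁
    obtain ⟨t', ht', h2⟩ := h.exists_term t₂
    refine ⟨.equal t t', ⟨ht, ht'⟩, Set.ext fun z => ?_⟩
    change _ ↔ t.eval M z = t'.eval M z
    rw [h1, h2]
    have : Sum.elim (fun a => z (.inl a)) (fun j => z (.inr j)) = z :=
      Sum.elim_comp_inl_inr z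
    change FirstOrder.Language.Term.realize (Sum.elim _ _) _ =
      FirstOrder.Language.Term.realize (Sum.elim _ _) _ ↔ _
    rw [this]
  | @rel n l r ts =>
    obtain rfl : l = 2 := by cases r; rfl
    obtain rfl : r = BaseRel.R := by cases r; rfl
    choose t ht h1 using fun i => h.exists_term (ts i)
    obtain ⟨φ, hφ, h2⟩ := h.rel (t 0) (t 1) (ht 0) (ht 1)
    refine ⟨φ, hφ, Set.ext fun z => ?_⟩
    refine Iff.trans ?_ (h2 z).symm
    have h3 : Sum.elim (fun a => z (.inl a)) (fun j => z (.inr j)) = z :=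
      Sum.elim_comp_inl_inr z
    have h4 : ∀ i, (ts i).realize (Sum.elim (fun a => z (.inl a)) fun j => z (.inr j)) =
        ![(t 0).eval M z, (t 1).eval M z] i := by
      intro i
      rw [h3]
      fin_cases i
      · exact (h1 0 z).symm
      · exact (h1 1 z).symm
    exact iff_of_eq (congrArg
      (FirstOrder.Language.Structure.RelMap (L := baseLanguage) (n := 2) BaseRel.R) (funext h4))
  | imp φ ψ ih1 ih2 => exact ih1.imp ih2
  | @all n φ ih =>
    let τ : Option (α ⊕ Fin n) → S := extendContext s fun _ => s
    have hlast : ∀ j : Fin (n + 1), ∃ t : MSTerm L τ s, t.IsOver T ∧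
        ∀ (z : α ⊕ Fin n → M.carrier s) (a : M.carrier s),
          t.eval M (extendAssignment (σ := fun _ => s) a z) =
            Fin.snoc (α := fun _ => M.carrier s) (fun j => z (.inr j)) a j := by
      intro j
      refine Fin.lastCases ⟨.var (σ := τ) none, h.mem, fun z a => ?_⟩
        (fun k => ⟨.var (σ := τ) (some (.inr k)), h.mem, fun z a => ?_⟩) j
      · rw [Fin.snoc_last]; rfl
      · rw [Fin.snoc_castSucc]; rfl
    choose t ht hlast using hlast
    let f : ∀ _ : α ⊕ Fin (n + 1), MSTerm L τ s
      | .inl i => .var (σ := τ) (some (.inl i))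
      | .inr j => t j
    have hf : ∀ z, (f z).IsOver T := by
      rintro (i | j)
      · exact h.mem
      · exact ht j
    refine ((ih.subst f hf).forall_extend h.mem).congr fun z => forall_congr' fun a => ?_
    exact iff_of_eq (congrArg (φ.Realize _) (funext fun j => hlast j z a))

theorem msDefinable (h : ExtendsBase M T s) {α : Type} {X : Set (α → M.carrier s)}
    (hX : (∅ : Set (M.carrier s)).Definable baseLanguage X) :
    MSDefinable M T (fun _ : α => s) X := by
  obtain ⟨φ, rfl⟩ := Set.empty_definable_iff.1 hX
  refine ((h.msDefinable_boundedFormula φ).subst (τ := fun _ : α => s)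
    (fun z => Sum.elim (fun a => .var (σ := fun _ : α => s) a) (fun j => j.elim0) z) ?_).congr
    fun z => ?_
  · rintro (a | j)
    · exact h.mem
    · exact j.elim0
  · exact iff_of_eq (congrArg (FirstOrder.Language.BoundedFormula.Realize φ z)
      (funext fun j => j.elim0))

end ExtendsBase

end ManySorted

/-! ### Observables and normal forms -/

section NormalForm

variable {p : ℕ} {V W : Type u} [AddCommGroup V] [Module (ZMod p) V]
  [AddCommGroup W] [Module (ZMod p) W] {β : V →ₗ[ZMod p] V →ₗ[ZMod p] W}

/-- The sorts of `(V, +, 0, R)^eq` are coded by tuples of vectors. -/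
@[reducible] def codedSort : ∀ s : ExpSort β, s ≠ .target → Coded β (expCarrier β s)
  | .vec, _ => inferInstanceAs (Coded β V)
  | .imag E, _ => inferInstanceAs (Coded β (Quotient E.rel))
  | .target, hs => absurd rfl hs

/-- The assignments of values in the expansion to the variables of a context. -/
abbrev Assignment {ι : Type} (σ : ι → ExpSort β) := ∀ i, expCarrier β (σ i)

/-- The identification of the carrier of a sort equal to `W` with `W`. -/
def targetCast : {s : ExpSort β} → s = .target → expCarrier β s → W
  | _, rfl, w => w

variable [NeZero p] (h : OrderDefinable β) {ι : Type} {σ : ι → ExpSort β}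

/-- The elementary maps from assignments to the sorts of `(V, +, 0, R)^eq`: the maps `fₙ(t)`, for
`t` a term of sort `W`, and the variables of sort different from `W`. -/
inductive Observable (σ : ι → ExpSort β)
  | ord (n : ℕ) (t : MSTerm (expLanguage β h) σ .target)
  | var (i : ι) (hi : σ i ≠ .target)

variable {h}

namespace Observable

/-- The sort of the values of an observable. -/
def sort (O : Observable h σ) : ExpSort β :=
  Observable.casesOn O (fun n _ => .imag (orderSort β h n)) fun i _ => σ i

theorem sort_ne (O : Observable h σ) : O.sort ≠ .target := by
  cases O with
  | ord n t => exact nofun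
  | var i hi => exact hi

instance (O : Observable h σ) : Coded β (expCarrier β O.sort) := codedSort _ O.sort_ne

/-- The value of an observable. -/
noncomputable def eval (ρ : Assignment σ) (O : Observable h σ) : expCarrier β O.sort :=
  Observable.casesOn (motive := fun O => expCarrier β O.sort) O
    (fun n t => orderFun h n (t.eval (expStructure β h) ρ)) fun i _ => ρ i

end Observable

variable (h)

/-- The map on assignments is a definable function of finitely many observables. -/
def IsObservable (σ : ι → ExpSort β) {A : Type*} [Coded β A] (Φ : Assignment σ → A) : Prop :=
  ∃ (J : Type) (_ : Finite J) (O : J → Observable h σ)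
    (H : (∀ j, expCarrier β (O j).sort) → A), DMap β H ∧ ∀ ρ, Φ ρ = H fun j => (O j).eval ρ

/-- The set of assignments is defined by a condition, definable in `(V, +, 0, R)^eq`, on finitely
many observables. -/
def HasNormalForm (σ : ι → ExpSort β) (X : Set (Assignment σ)) : Prop :=
  ∃ (J : Type) (_ : Finite J) (O : J → Observable h σ)
    (D : Set (∀ j, expCarrier β (O j).sort)), DSet β D ∧
      ∀ ρ, ρ ∈ X ↔ (fun j => (O j).eval ρ) ∈ D

/-- The map from assignments to `W` is given by a term. -/
def IsTermFun (σ : ι → ExpSort β) (F : Assignment σ → W) : Prop :=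
  ∃ t : MSTerm (expLanguage β h) σ .target, ∀ ρ, t.eval (expStructure β h) ρ = F ρ

variable {h}

namespace IsObservable

variable {A : Type*} {B : Type*} [Coded β A] [Coded β B]

theorem eval (O : Observable h σ) : IsObservable h σ fun ρ => O.eval ρ :=
  ⟨Unit, inferInstance, fun _ => O, fun z => z (), DMap.eval (), fun _ => rfl⟩

theorem comp {Φ : Assignment σ → A} (hΦ : IsObservable h σ Φ) {g : A → B} (hg : DMap β g) :
    IsObservable h σ fun ρ => g (Φ ρ) := by
  obtain ⟨J, hJ, O, H, hH, hΦ⟩ := hΦ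
  exact ⟨J, hJ, O, fun z => g (H z), hg.comp hH, fun ρ => congrArg g (hΦ ρ)⟩

theorem prodMk {Φ : Assignment σ → A} {Ψ : Assignment σ → B} (hΦ : IsObservable h σ Φ)
    (hΨ : IsObservable h σ Ψ) : IsObservable h σ fun ρ => (Φ ρ, Ψ ρ) := by
  obtain ⟨J, hJ, O, H, hH, hΦ⟩ := hΦ
  obtain ⟨J', hJ', O', H', hH', hΨ⟩ := hΨ
  refine ⟨J ⊕ J', inferInstance, Sum.elim O O',
    fun z => (H fun j => z (.inl j), H' fun j => z (.inr j)), ?_,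
    fun ρ => Prod.ext (hΦ ρ) (hΨ ρ)⟩
  exact (hH.comp (DMap.pi fun j => DMap.eval (F := fun j => expCarrier β (Sum.elim O O' j).sort)
    (.inl j))).prodMk (hH'.comp (DMap.pi fun j => DMap.eval
      (F := fun j => expCarrier β (Sum.elim O O' j).sort) (.inr j)))

theorem pi {κ : Type} [Finite κ] {F : κ → Type*} [∀ k, Coded β (F k)]
    {Φ : ∀ k, Assignment σ → F k} (hΦ : ∀ k, IsObservable h σ (Φ k)) :
    IsObservable h σ fun ρ k => Φ k ρ := by
  choose J hJ O H hH hΦ using hΦ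
  refine ⟨Σ k, J k, inferInstance, fun j => O j.1 j.2, fun z k => H k fun j => z ⟨k, j⟩, ?_,
    fun ρ => funext fun k => hΦ k ρ⟩
  exact DMap.pi fun k => (hH k).comp (DMap.pi fun j =>
    DMap.eval (F := fun j : Σ k, J k => expCarrier β (O j.1 j.2).sort) ⟨k, j⟩)

theorem const {a : A} (ha : DSet β {a}) : IsObservable h σ fun _ => a :=
  ⟨Empty, inferInstance, fun j => j.elim, fun _ => a, DMap.const ha, fun _ => rfl⟩

theorem preimage {Φ : Assignment σ → A} (hΦ : IsObservable h σ Φ) {D : Set A} (hD : DSet β D) :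
    HasNormalForm h σ {ρ | Φ ρ ∈ D} := by
  obtain ⟨J, hJ, O, H, hH, hΦ⟩ := hΦ
  refine ⟨J, hJ, O, {z | H z ∈ D}, hH.preimage hD, fun ρ => ?_⟩
  rw [Set.mem_ofPred_eq, hΦ]
  rfl

theorem setOf_eq {Φ Ψ : Assignment σ → A} (hΦ : IsObservable h σ Φ) (hΨ : IsObservable h σ Ψ) :
    HasNormalForm h σ {ρ | Φ ρ = Ψ ρ} :=
  (hΦ.prodMk hΨ).preimage (D := {q : A × A | q.1 = q.2}) DMap.id

end IsObservable

namespace HasNormalForm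

variable {X Y : Set (Assignment σ)}

theorem congr (hX : HasNormalForm h σ X) (hXY : ∀ x, x ∈ X ↔ x ∈ Y) : HasNormalForm h σ Y :=
  Set.ext hXY ▸ hX

theorem compl (hX : HasNormalForm h σ X) : HasNormalForm h σ Xᶜ := by
  obtain ⟨J, hJ, O, D, hD, hX⟩ := hX
  exact ⟨J, hJ, O, Dᶜ, hD.compl, fun ρ => not_congr (hX ρ)⟩

theorem inter (hX : HasNormalForm h σ X) (hY : HasNormalForm h σ Y) :
    HasNormalForm h σ (X ∩ Y) := by
  obtain ⟨J, hJ, O, D, hD, hX⟩ := hX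
  obtain ⟨J', hJ', O', D', hD', hY⟩ := hY
  refine (((IsObservable.pi fun j => IsObservable.eval (O j)).prodMk
    (IsObservable.pi fun j => IsObservable.eval (O' j))).preimage
    ((DMap.fst.preimage hD).inter (DMap.snd.preimage hD'))).congr fun ρ =>
      and_congr (hX ρ).symm (hY ρ).symm

theorem union (hX : HasNormalForm h σ X) (hY : HasNormalForm h σ Y) :
    HasNormalForm h σ (X ∪ Y) :=
  (hX.compl.inter hY.compl).compl.congr fun _ => by
    simp only [Set.mem_compl_iff, Set.mem_inter_iff, Set.mem_union]; tauto

theorem const (P : Prop) : HasNormalForm h σ {_ρ : Assignment σ | P} :=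
  ⟨Empty, inferInstance, fun j => j.elim, {_z | P}, DSet.const P, fun _ => Iff.rfl⟩

theorem iUnion {κ : Type*} [Finite κ] {X : κ → Set (Assignment σ)}
    (hX : ∀ k, HasNormalForm h σ (X k)) : HasNormalForm h σ (⋃ k, X k) := by
  classical
  have := Fintype.ofFinite κ
  have key : ∀ s : Finset κ, HasNormalForm h σ (⋃ k ∈ s, X k) := by
    intro s
    induction s using Finset.induction_on with
    | empty => exact (const False).congr fun ρ => by simp
    | insert a s _ ih => simpa only [Finset.set_biUnion_insert] using (hX a).union ih
  simpa using key Finset.univ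

theorem iInter {κ : Type*} [Finite κ] {X : κ → Set (Assignment σ)}
    (hX : ∀ k, HasNormalForm h σ (X k)) : HasNormalForm h σ (⋂ k, X k) := by
  simpa using (iUnion fun k => (hX k).compl).compl

end HasNormalForm

namespace IsTermFun

theorem zero : IsTermFun h σ fun _ => 0 :=
  ⟨.func (L := expLanguage β h) ExpFunc.targetZero fun i => Fin.elim0 i, fun _ => rfl⟩

theorem add {F G : Assignment σ → W} (hF : IsTermFun h σ F) (hG : IsTermFun h σ G) :
    IsTermFun h σ fun ρ => F ρ + G ρ := by
  obtain ⟨s, hs⟩ := hF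
  obtain ⟨t, ht⟩ := hG
  refine ⟨.func (L := expLanguage β h) ExpFunc.targetAdd
    (fun i : Fin 2 => (![s, t] : Fin 2 → MSTerm (expLanguage β h) σ .target) i), fun ρ => ?_⟩
  exact congrArg₂ (fun a b : W => a + b) (hs ρ) (ht ρ)

theorem nsmul {F : Assignment σ → W} (hF : IsTermFun h σ F) (n : ℕ) :
    IsTermFun h σ fun ρ => n • F ρ := by
  induction n with
  | zero => simpa using zero
  | succ n ih => simpa only [succ_nsmul] using ih.add hF

theorem smul {F : Assignment σ → W} (hF : IsTermFun h σ F) (c : ZMod p) :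
    IsTermFun h σ fun ρ => c • F ρ := by
  simpa only [← Nat.cast_smul_eq_nsmul (ZMod p), ZMod.natCast_zmod_val] using hF.nsmul c.val

theorem sub {F G : Assignment σ → W} (hF : IsTermFun h σ F) (hG : IsTermFun h σ G) :
    IsTermFun h σ fun ρ => F ρ - G ρ := by
  simpa [sub_eq_add_neg] using hF.add (hG.smul (-1))

theorem var (i : ι) (hi : σ i = .target) : IsTermFun h σ fun ρ => targetCast hi (ρ i) := by
  have : ∀ {s : ExpSort β} (t : MSTerm (expLanguage β h) σ s) (hs : s = .target),
      ∃ t' : MSTerm (expLanguage β h) σ .target, ∀ ρ, t'.eval (expStructure β h) ρ =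
        targetCast hs (t.eval (expStructure β h) ρ) := by
    rintro _ t rfl
    exact ⟨t, fun _ => rfl⟩
  exact this (.var i) hi

/-- The maps given by terms of sort `W` are generated by the variables under addition. -/
theorem induction {P : (Assignment σ → W) → Prop}
    (var : ∀ i (hi : σ i = .target), P fun ρ => targetCast hi (ρ i))
    (zero : P fun _ => 0) (add : ∀ F G, P F → P G → P fun ρ => F ρ + G ρ)
    (t : MSTerm (expLanguage β h) σ .target) : P fun ρ => t.eval (expStructure β h) ρ := by
  have key : ∀ {s : ExpSort β} (t : MSTerm (expLanguage β h) σ s) (hs : s = .target),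
      P fun ρ => targetCast hs (t.eval (expStructure β h) ρ) := by
    intro s t
    induction t with
    | var i => exact var i
    | func f ts ih =>
      cases f with
      | vecZero => exact fun hs => nomatch hs
      | vecAdd => exact fun hs => nomatch hs
      | proj E i => exact fun hs => nomatch hs
      | order n => exact fun hs => nomatch hs
      | targetZero => exact fun _ => zero
      | targetAdd => exact fun _ => add _ _ (ih (0 : Fin 2) rfl) (ih (1 : Fin 2) rfl)
  exact key t rfl

theorem isObservable_orderFun {F : Assignment σ → W} (hF : IsTermFun h σ F) (n : ℕ) :
    IsObservable h σ fun ρ => orderFun h n (F ρ) := by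
  obtain ⟨t, ht⟩ := hF
  obtain rfl : (fun ρ => t.eval (expStructure β h) ρ) = F := funext ht
  exact IsObservable.eval (Observable.ord n t)

theorem setOf_mem_orderRange {F : Assignment σ → W} (hF : IsTermFun h σ F) (n : ℕ) :
    HasNormalForm h σ {ρ | F ρ ∈ orderRange β n} := by
  refine ((hF.isObservable_orderFun n).preimage (dSet_orderNone n).compl).congr fun ρ => ?_
  rw [Set.mem_ofPred_eq, Set.mem_ofPred_eq, Set.mem_compl_iff, Set.mem_singleton_iff,
    ← (orderVal_injective h n).eq_iff, orderVal_orderNone]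
  by_cases hw : F ρ ∈ orderRange β n
  · simp [orderVal_orderFun hw, hw]
  · simp [orderVal_orderFun_of_notMem hw, hw]

theorem setOf_eq {F G : Assignment σ → W} (hF : IsTermFun h σ F) (hG : IsTermFun h σ G) :
    HasNormalForm h σ {ρ | F ρ = G ρ} :=
  ((hF.sub hG).setOf_mem_orderRange 0).congr fun ρ => by
    rw [Set.mem_ofPred_eq, orderRange_zero, Set.mem_singleton_iff, sub_eq_zero]; rfl

end IsTermFun

omit [NeZero p] in
theorem dSet_singleton_zero : DSet β {(0 : V)} := fun _ =>
  (IsBaseTerm.var _).isBaseDefinable_eq IsBaseTerm.zero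

omit [NeZero p] in
theorem dMap_add : DMap β fun q : V × V => q.1 + q.2 := fun _ =>
  ((IsBaseTerm.var _).add (IsBaseTerm.var _)).isBaseDefinable_eq (IsBaseTerm.var _)

omit [NeZero p] in
theorem dSet_form_eq_zero : DSet β {q : V × V | β q.1 q.2 = 0} := fun _ =>
  (IsBaseTerm.var _).isBaseDefinable_apply_eq_zero (IsBaseTerm.var _)

omit [NeZero p] in
theorem dMap_mk (E : ImagSort β) (i : E.ι) :
    DMap β fun x : Fin (E.n i) → V => (Quotient.mk E.rel ⟨i, x⟩ : Quotient E.rel) := fun j =>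
  (Coded.isBaseDefinable_eq (β := β) (A := Quotient E.rel) i j.2).comp
    (Sum.map (fun k => (⟨k, ()⟩ : Σ _ : Fin (E.n i), Unit)) _root_.id)

/-- A term whose sort is different from `W` is a definable function of observables: a subterm of
sort `W` can occur in it only below one of the maps `fₙ`. -/
theorem isObservable_term {s : ExpSort β} (t : MSTerm (expLanguage β h) σ s)
    (hs : s ≠ .target) : @IsObservable _ _ _ _ _ _ _ _ _ h _ σ (expCarrier β s) (codedSort s hs)
      fun ρ => t.eval (expStructure β h) ρ := by
  induction t with
  | var i => exact IsObservable.eval (Observable.var i hs)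
  | func f ts ih =>
    cases f with
    | vecZero => exact IsObservable.const (A := V) dSet_singleton_zero
    | vecAdd =>
      have h0 : IsObservable h σ (A := V) fun ρ => (ts (0 : Fin 2)).eval (expStructure β h) ρ :=
        ih (0 : Fin 2) nofun
      have h1 : IsObservable h σ (A := V) fun ρ => (ts (1 : Fin 2)).eval (expStructure β h) ρ :=
        ih (1 : Fin 2) nofun
      exact (h0.prodMk h1).comp dMap_add
    | proj E i =>
      have h0 : ∀ k : Fin (E.n i), IsObservable h σ (A := V) fun ρ =>
          (ts k).eval (expStructure β h) ρ := fun k => ih k nofun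
      have h1 := (IsObservable.pi (F := fun _ => V)
        (Φ := fun k ρ => (ts k).eval (expStructure β h) ρ) h0).comp (dMap_mk E i)
      exact h1
    | order n => exact IsObservable.eval (Observable.ord n (ts (0 : Fin 1)))
    | targetZero => exact absurd rfl hs
    | targetAdd => exact absurd rfl hs

end NormalForm

/-! ### Elimination of quantifiers -/

section Elimination

variable {p : ℕ} [Fact p.Prime] {V W : Type u} [AddCommGroup V] [Module (ZMod p) V]
  [AddCommGroup W] [Module (ZMod p) W] {β : V →ₗ[ZMod p] V →ₗ[ZMod p] W}
  {h : OrderDefinable β} {ι : Type} {σ : ι → ExpSort β}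

/-- Surjectivity of a family with finite index set depends only on its kernel. -/
theorem surjective_of_kernel_eq {J Q : Type*} [Finite J] {f g : J → Q}
    (hfg : ∀ i j, f i = f j ↔ g i = g j) (hf : Function.Surjective f) :
    Function.Surjective g := by
  obtain ⟨s, hs⟩ := hf.hasRightInverse
  have hinj : Function.Injective (g ∘ s) := fun a b hab => by
    have := (hfg (s a) (s b)).2 hab
    rwa [hs, hs] at this
  have := Finite.of_surjective f hf
  intro q
  obtain ⟨a, ha⟩ := (Finite.injective_iff_surjective.1 hinj) q
  exact ⟨s a, ha⟩

/-- The condition that given translates of the set of elements of order at most `N` do not cover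
`W`. Either it always holds, or the span of the image of `β` consists of the elements of order
at most some `N'`; in the latter case the elements of a coset of this span which is met by the
translates are parametrized by `B_{N'}`, and the existence of another coset depends only on which
of the translates lie in the same coset. -/
theorem HasNormalForm.exists_forall_notMem (halt : β.IsAlt) (hsep : IsSeparatedSystem β)
    {J : Type} [Finite J] (N : ℕ) {r : J → Assignment σ → W} (hr : ∀ j, IsTermFun h σ (r j)) :
    HasNormalForm h σ {ρ | ∃ w, ∀ j, w + r j ρ ∉ orderRange β N} := by
  by_cases hcov : ∃ r : J → W, ∀ w, ∃ j, w + r j ∈ orderRange β N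
  swap
  · push Not at hcov
    exact (HasNormalForm.const True).congr fun ρ => iff_of_true trivial (hcov fun j => r j ρ)
  obtain ⟨r₀, hr₀⟩ := hcov
  obtain ⟨N', hN', hspan⟩ := exists_orderRange_eq_orderSpan halt hr₀
  -- the case of a coset of the span which is not met by the translates
  have h1 : HasNormalForm h σ {ρ | ∃ w, ∀ j, w + r j ρ ∉ orderSpan β halt} := by
    let P : Assignment σ → J × J → Prop := fun ρ k => r k.1 ρ - r k.2 ρ ∈ orderRange β N'
    have hP : ∀ Q : Set (J × J), HasNormalForm h σ {ρ | ∀ k, P ρ k ↔ k ∈ Q} := by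
      intro Q
      refine (HasNormalForm.iInter (X := fun k => {ρ | P ρ k ↔ k ∈ Q}) fun k => ?_).congr
        fun ρ => Set.mem_iInter
      have hk := ((hr k.1).sub (hr k.2)).setOf_mem_orderRange N'
      by_cases hkQ : k ∈ Q
      · exact hk.congr fun ρ => by
          rw [Set.mem_ofPred_eq, Set.mem_ofPred_eq, iff_true_right hkQ]
      · exact hk.compl.congr fun ρ => by
          rw [Set.mem_ofPred_eq, iff_false_right hkQ]; rfl
    have hinv : ∀ ρ ρ', (∀ k, P ρ k ↔ P ρ' k) → (∃ w, ∀ j, w + r j ρ' ∉ orderSpan β halt) →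
        ∃ w, ∀ j, w + r j ρ ∉ orderSpan β halt := by
      rintro ρ ρ' hρ ⟨w, hw⟩
      by_contra! hne
      have hmk : ∀ ρ i j, (QuotientAddGroup.mk (s := orderSpan β halt) (-r i ρ) =
          QuotientAddGroup.mk (-r j ρ)) ↔ P ρ (i, j) := by
        intro ρ i j
        rw [QuotientAddGroup.eq, hspan, neg_neg, ← sub_eq_add_neg]
      have hsurj : Function.Surjective fun j =>
          QuotientAddGroup.mk (s := orderSpan β halt) (-r j ρ) := by
        intro q
        obtain ⟨x, rfl⟩ := QuotientAddGroup.mk_surjective q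
        obtain ⟨j, hj⟩ := hne x
        refine ⟨j, ?_⟩
        rwa [QuotientAddGroup.eq, neg_neg, add_comm]
      obtain ⟨j, hj⟩ := surjective_of_kernel_eq
        (fun i j => (hmk ρ i j).trans ((hρ (i, j)).trans (hmk ρ' i j).symm)) hsurj
        (QuotientAddGroup.mk w)
      refine hw j ?_
      rw [QuotientAddGroup.eq, neg_neg] at hj
      rwa [add_comm]
    refine (HasNormalForm.iUnion (κ := {Q : Set (J × J) // ∃ ρ, (∀ k, P ρ k ↔ k ∈ Q) ∧
      ∃ w, ∀ j, w + r j ρ ∉ orderSpan β halt}) fun Q => hP Q.1).congr fun ρ => ?_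
    rw [Set.mem_iUnion]
    constructor
    · rintro ⟨⟨Q, ρ', hQ, hw⟩, hρ⟩
      exact hinv ρ ρ' (fun k => (hρ k).trans (hQ k).symm) hw
    · exact fun hw => ⟨⟨{k | P ρ k}, ρ, fun k => Iff.rfl, hw⟩, fun k => Iff.rfl⟩
  -- the case of a coset of the span which is met by the translate `i`
  have h2 : ∀ i, HasNormalForm h σ {ρ | ∃ b ∈ orderRange β N', ∀ j,
      b + (r j ρ - r i ρ) ∉ orderRange β N} := by
    intro i
    have hΨ := IsObservable.pi fun j => ((hr j).sub (hr i)).isObservable_orderFun (N + N')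
    let G : OrdSort h N' → OrdSort h (N + N') → OrdSort h N := fun b c =>
      orderLift h N (Option.map₂ (fun w w' => (1 : ZMod p) • w + (1 : ZMod p) • w')
        (orderVal h N' b) (orderVal h (N + N') c))
    have hG : DMap β fun q : OrdSort h N' × OrdSort h (N + N') => G q.1 q.2 :=
      ((isChartQuadratic_orderVal N').map₂ (isChartQuadratic_orderVal (N + N')) 1 1).dMap_orderLift
        halt hsep N
    have hD1 : DSet β {q : (J → OrdSort h (N + N')) × OrdSort h N' | q.2 ≠ orderNone h N'} :=
      DMap.snd.preimage (dSet_orderNone N').compl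
    have hD2 : ∀ j, DSet β {q : (J → OrdSort h (N + N')) × OrdSort h N' |
        G q.2 (q.1 j) = orderNone h N} := fun j =>
      (hG.comp (DMap.snd.prodMk ((DMap.eval j).comp DMap.fst))).preimage (dSet_orderNone N)
    refine (hΨ.preimage (hD1.inter (DSet.iInter hD2)).exists_snd).congr fun ρ => ?_
    simp only [Set.mem_ofPred_eq, Set.mem_inter_iff, Set.mem_iInter]
    have key : ∀ b ∈ orderRange β N', ∀ j, G (orderFun h N' b)
        (orderFun h (N + N') (r j ρ - r i ρ)) = orderNone h N ↔
          b + (r j ρ - r i ρ) ∉ orderRange β N := by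
      intro b hb j
      simp only [G]
      rw [orderLift_map₂ halt hb, one_smul, orderFun_eq_orderNone_iff]
    constructor
    · rintro ⟨b, hb, hb'⟩
      obtain ⟨w, hw, rfl⟩ := exists_orderFun_eq hb
      exact ⟨w, hw, fun j => (key w hw j).1 (hb' j)⟩
    · rintro ⟨w, hw, hw'⟩
      exact ⟨orderFun h N' w, fun hb => orderFun_eq_orderNone_iff.1 hb hw,
        fun j => (key w hw j).2 (hw' j)⟩
  refine (h1.union (HasNormalForm.iUnion h2)).congr fun ρ => ?_
  rw [Set.mem_union, Set.mem_iUnion]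
  constructor
  · rintro (⟨w, hw⟩ | ⟨i, b, hb, hw⟩)
    · exact ⟨w, fun j hj => hw j ⟨N, hj⟩⟩
    · refine ⟨b - r i ρ, fun j hj => hw j ?_⟩
      convert hj using 1
      abel
  · rintro ⟨w, hw⟩
    by_cases hex : ∀ j, w + r j ρ ∉ orderSpan β halt
    · exact .inl ⟨w, hex⟩
    · push Not at hex
      obtain ⟨i, hi⟩ := hex
      refine .inr ⟨i, w + r i ρ, (hspan _).1 hi, fun j hj => hw j ?_⟩
      convert hj using 1
      abel

/-- Elimination of a quantifier over `W` from a condition on the elements `f_N(c_j w + F_j)` and on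
parameters from `(V, +, 0, R)^eq`. If some `c_k w + F_k` with `c_k ≠ 0` has order at most `N`, then
it can be replaced by a variable of the sort `B_N`, and `f_N(c_j w + F_j)` is determined by this
variable and by `f_{2N}(F_j - c_j c_k⁻¹ F_k)`. Otherwise all the elements `f_N(c_j w + F_j)` with
`c_j ≠ 0` are equal to `u`. -/
theorem HasNormalForm.exists_target_aux (halt : β.IsAlt) (hsep : IsSeparatedSystem β)
    {J : Type} [Finite J] (N : ℕ) (c : J → ZMod p) {F : J → Assignment σ → W}
    (hF : ∀ j, IsTermFun h σ (F j)) {A : Type*} [Coded β A] {Φ : Assignment σ → A}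
    (hΦ : IsObservable h σ Φ) {D : Set ((J → OrdSort h N) × A)} (hD : DSet β D) :
    HasNormalForm h σ
      {ρ | ∃ w, ((fun j => orderFun h N (c j • w + F j ρ)), Φ ρ) ∈ D} := by
  classical
  have h1 : ∀ k, HasNormalForm h σ {ρ | ∃ b ∈ orderRange β N,
      ((fun j => orderFun h N ((c j * (c k)⁻¹) • b + (F j ρ - (c j * (c k)⁻¹) • F k ρ))), Φ ρ)
        ∈ D} := by
    intro k
    have hΨ := (IsObservable.pi fun j => ((hF j).sub
      ((hF k).smul (c j * (c k)⁻¹))).isObservable_orderFun (N + N)).prodMk hΦ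
    let G : J → OrdSort h N → OrdSort h (N + N) → OrdSort h N := fun j b d =>
      orderLift h N (Option.map₂ (fun w w' => (c j * (c k)⁻¹) • w + (1 : ZMod p) • w')
        (orderVal h N b) (orderVal h (N + N) d))
    have hG : ∀ j, DMap β fun q : OrdSort h N × OrdSort h (N + N) => G j q.1 q.2 := fun j =>
      ((isChartQuadratic_orderVal N).map₂ (isChartQuadratic_orderVal (N + N)) _ 1).dMap_orderLift
        halt hsep N
    have hD1 : DSet β {q : ((J → OrdSort h (N + N)) × A) × OrdSort h N | q.2 ≠ orderNone h N} :=
      DMap.snd.preimage (dSet_orderNone N).compl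
    have hD2 : DSet β {q : ((J → OrdSort h (N + N)) × A) × OrdSort h N |
        ((fun j => G j q.2 (q.1.1 j)), q.1.2) ∈ D} :=
      ((DMap.pi fun j => (hG j).comp (DMap.snd.prodMk
        ((DMap.eval j).comp (DMap.fst.comp DMap.fst)))).prodMk
          (DMap.snd.comp DMap.fst)).preimage hD
    refine (hΨ.preimage (hD1.inter hD2).exists_snd).congr fun ρ => ?_
    simp only [Set.mem_ofPred_eq, Set.mem_inter_iff]
    have key : ∀ b ∈ orderRange β N, ∀ j, G j (orderFun h N b)
        (orderFun h (N + N) (F j ρ - (c j * (c k)⁻¹) • F k ρ)) =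
          orderFun h N ((c j * (c k)⁻¹) • b + (F j ρ - (c j * (c k)⁻¹) • F k ρ)) :=
      fun b hb j => orderLift_map₂ halt hb _
    constructor
    · rintro ⟨b, hb, hb'⟩
      obtain ⟨w, hw, rfl⟩ := exists_orderFun_eq hb
      simp only [key w hw] at hb'
      exact ⟨w, hw, hb'⟩
    · rintro ⟨w, hw, hw'⟩
      refine ⟨orderFun h N w, fun hb => orderFun_eq_orderNone_iff.1 hb hw, ?_⟩
      simp only [key w hw]
      exact hw'
  have h2 : HasNormalForm h σ
      {ρ | ((fun j => if c j = 0 then orderFun h N (F j ρ) else orderNone h N), Φ ρ) ∈ D} := by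
    refine ((IsObservable.pi fun j => ?_).prodMk hΦ).preimage hD
    split_ifs
    · exact (hF j).isObservable_orderFun N
    · exact IsObservable.const (dSet_orderNone N)
  have h3 := HasNormalForm.exists_forall_notMem halt hsep N
    fun j : {j // c j ≠ 0} => (hF j).smul (c j)⁻¹
  refine ((HasNormalForm.iUnion fun k : {k // c k ≠ 0} => h1 k).union (h2.inter h3)).congr
    fun ρ => ?_
  simp only [Set.mem_union, Set.mem_iUnion, Set.mem_inter_iff, Set.mem_ofPred_eq]
  constructor
  · rintro (⟨⟨k, hk⟩, b, hb, hb'⟩ | ⟨h4, w, hw⟩)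
    · refine ⟨(c k)⁻¹ • (b - F k ρ), ?_⟩
      convert hb' using 4 with j
      rw [smul_smul, smul_sub]
      abel
    · refine ⟨w, ?_⟩
      convert h4 using 3 with j
      split_ifs with hj
      · rw [hj, zero_smul, zero_add]
      · refine orderFun_of_notMem fun hn => hw ⟨j, hj⟩ ?_
        have := smul_mem_orderRange halt hn (c j)⁻¹
        rwa [smul_add, smul_smul, inv_mul_cancel₀ hj, one_smul] at this
  · rintro ⟨w, hw⟩
    by_cases hex : ∃ k, c k ≠ 0 ∧ c k • w + F k ρ ∈ orderRange β N
    · obtain ⟨k, hk, hkw⟩ := hex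
      refine .inl ⟨⟨k, hk⟩, _, hkw, ?_⟩
      convert hw using 4 with j
      rw [smul_add, smul_smul, inv_mul_cancel_right₀ hk]
      abel
    · push Not at hex
      refine .inr ⟨?_, w, fun ⟨j, hj⟩ hn => hex j hj ?_⟩
      · convert hw using 3 with j
        split_ifs with hj
        · rw [hj, zero_smul, zero_add]
        · exact (orderFun_of_notMem (hex j hj)).symm
      · have := smul_mem_orderRange halt hn (c j)
        rwa [smul_add, smul_smul, mul_inv_cancel₀ hj, one_smul] at this

/-- Elimination of a quantifier over a sort of `(V, +, 0, R)^eq`. -/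
theorem HasNormalForm.exists_of_ne {s : ExpSort β} (hs : s ≠ .target)
    {X : Set (Assignment (extendContext s σ))} (hX : HasNormalForm h (extendContext s σ) X) :
    HasNormalForm h σ {ρ | ∃ a : expCarrier β s, (extendAssignment a ρ : Assignment _) ∈ X} := by
  let _ := codedSort s hs
  have hterm : ∀ t : MSTerm (expLanguage β h) (extendContext s σ) .target,
      ∃ F, IsTermFun h σ F ∧ ∀ (ρ : Assignment σ) (a : expCarrier β s),
        t.eval (expStructure β h) (extendAssignment a ρ) = F ρ := by
    refine fun t => IsTermFun.induction (P := fun f => ∃ F, IsTermFun h σ F ∧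
      ∀ (ρ : Assignment σ) (a : expCarrier β s), f (extendAssignment a ρ) = F ρ) ?_ ?_ ?_ t
    · rintro (_ | i) hi
      · exact absurd hi hs
      · exact ⟨_, IsTermFun.var i hi, fun _ _ => rfl⟩
    · exact ⟨_, IsTermFun.zero, fun _ _ => rfl⟩
    · rintro f g ⟨F, hF, hf⟩ ⟨G, hG, hg⟩
      exact ⟨_, hF.add hG, fun ρ a => congrArg₂ (· + ·) (hf ρ a) (hg ρ a)⟩
  have hobs : ∀ O : Observable h (extendContext s σ), ∃ (A : Type u) (_ : Coded β A)
      (Φ : Assignment σ → A) (H : expCarrier β s × A → expCarrier β O.sort),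
      IsObservable h σ Φ ∧ DMap β H ∧ ∀ (ρ : Assignment σ) (a : expCarrier β s),
        O.eval (extendAssignment a ρ) = H (a, Φ ρ) := by
    rintro (⟨n, t⟩ | ⟨_ | i, hi⟩)
    · obtain ⟨F, hF, ht⟩ := hterm t
      exact ⟨OrdSort h n, inferInstance, _, _, hF.isObservable_orderFun n, DMap.snd,
        fun ρ a => congrArg (orderFun h n) (ht ρ a)⟩
    · exact ⟨PUnit, inferInstance, _, _, IsObservable.const (a := PUnit.unit)
        ((DSet.const True).congr fun _ => iff_of_true trivial rfl), DMap.fst, fun ρ a => rfl⟩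
    · exact ⟨_, codedSort (σ i) hi, _, _, IsObservable.eval (Observable.var i hi), DMap.snd,
        fun ρ a => rfl⟩
  obtain ⟨J, hJ, O, D, hD, hX⟩ := hX
  choose A hA Φ H hΦ hH hO using fun j => hobs (O j)
  have hD' : DSet β {q : (∀ j, A j) × expCarrier β s | (fun j => H j (q.2, q.1 j)) ∈ D} :=
    (DMap.pi fun j => (hH j).comp (DMap.snd.prodMk ((DMap.eval j).comp DMap.fst))).preimage hD
  refine ((IsObservable.pi hΦ).preimage hD'.exists_snd).congr fun ρ => exists_congr fun a => ?_
  rw [hX]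
  simp only [hO]
  rfl

/-- Elimination of a quantifier over `W`. The terms in which the quantified variable `w` occurs are
of the form `c w + F`, and the maps `fₙ` applied to them can be replaced by a single `f_N`. -/
theorem HasNormalForm.exists_target (halt : β.IsAlt) (hsep : IsSeparatedSystem β)
    {X : Set (Assignment (extendContext .target σ))}
    (hX : HasNormalForm h (extendContext .target σ) X) :
    HasNormalForm h σ {ρ | ∃ a : W, (extendAssignment (C := expCarrier β) (s := .target) a ρ :
      Assignment _) ∈ X} := by
  have hterm : ∀ t : MSTerm (expLanguage β h) (extendContext .target σ) .target,
      ∃ (c : ZMod p) (F : Assignment σ → W), IsTermFun h σ F ∧ ∀ (ρ : Assignment σ) (a : W),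
        t.eval (expStructure β h) (extendAssignment (C := expCarrier β) (s := .target) a ρ) =
          c • a + F ρ := by
    refine fun t => IsTermFun.induction (P := fun f => ∃ (c : ZMod p) (F : Assignment σ → W),
      IsTermFun h σ F ∧ ∀ (ρ : Assignment σ) (a : W),
        f (extendAssignment (C := expCarrier β) (s := .target) a ρ) = c • a + F ρ) ?_ ?_ ?_ t
    · rintro (_ | i) hi
      · exact ⟨1, _, IsTermFun.zero, fun ρ a => by rw [one_smul, add_zero]; rfl⟩
      · exact ⟨0, _, IsTermFun.var i hi, fun ρ a => by rw [zero_smul, zero_add]; rfl⟩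
    · exact ⟨0, _, IsTermFun.zero, fun ρ a => by rw [zero_smul, zero_add]⟩
    · rintro f g ⟨c, F, hF, hf⟩ ⟨d, G, hG, hg⟩
      exact ⟨c + d, _, hF.add hG, fun ρ a =>
        (congrArg₂ (· + ·) (hf ρ a) (hg ρ a)).trans (by rw [add_smul]; abel)⟩
  have hobs : ∀ O : Observable h (extendContext .target σ), ∃ (c : ZMod p) (F : Assignment σ → W)
      (n : ℕ) (A : Type u) (_ : Coded β A) (Φ : Assignment σ → A), IsTermFun h σ F ∧
      IsObservable h σ Φ ∧ ∀ N, n ≤ N → ∃ H : OrdSort h N × A → expCarrier β O.sort, DMap β H ∧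
        ∀ (ρ : Assignment σ) (a : W),
          O.eval (extendAssignment (C := expCarrier β) (s := .target) a ρ) =
            H (orderFun h N (c • a + F ρ), Φ ρ) := by
    rintro (⟨n, t⟩ | ⟨_ | i, hi⟩)
    · obtain ⟨c, F, hF, ht⟩ := hterm t
      refine ⟨c, F, n, PUnit, inferInstance, fun _ => PUnit.unit, hF, IsObservable.const
        ((DSet.const True).congr fun _ => iff_of_true trivial rfl), fun N hN => ?_⟩
      refine ⟨fun q => orderLift h n (orderVal h N q.1), ((isChartQuadratic_orderVal
        N).dMap_orderLift halt hsep n).comp DMap.fst, fun ρ a => ?_⟩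
      exact (congrArg (orderFun h n) (ht ρ a)).trans (orderLift_orderVal halt hN _).symm
    · exact absurd rfl hi
    · exact ⟨0, _, 0, _, codedSort (σ i) hi, _, IsTermFun.zero,
        IsObservable.eval (Observable.var i hi), fun N _ => ⟨_, DMap.snd, fun ρ a => rfl⟩⟩
  obtain ⟨J, hJ, O, D, hD, hX⟩ := hX
  have := Fintype.ofFinite J
  choose c F n A hA Φ hF hΦ hO using fun j => hobs (O j)
  choose H hH hO using fun j => hO j (∑ j, n j)
    (Finset.single_le_sum (fun _ _ => Nat.zero_le _) (Finset.mem_univ j))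
  have hD' : DSet β {q : (J → OrdSort h (∑ j, n j)) × (∀ j, A j) |
      (fun j => H j (q.1 j, q.2 j)) ∈ D} :=
    (DMap.pi fun j => (hH j).comp (((DMap.eval j).comp DMap.fst).prodMk
      ((DMap.eval j).comp DMap.snd))).preimage hD
  refine (HasNormalForm.exists_target_aux halt hsep _ c hF (IsObservable.pi hΦ) hD').congr
    fun ρ => exists_congr fun a => ?_
  rw [hX]
  simp only [hO]
  rfl

theorem HasNormalForm.exists_extend (halt : β.IsAlt) (hsep : IsSeparatedSystem β)
    {s : ExpSort β} {X : Set (Assignment (extendContext s σ))}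
    (hX : HasNormalForm h (extendContext s σ) X) :
    HasNormalForm h σ {ρ | ∃ a : expCarrier β s, (extendAssignment a ρ : Assignment _) ∈ X} := by
  by_cases hs : s = .target
  · subst hs
    exact hX.exists_target halt hsep
  · exact hX.exists_of_ne hs

theorem HasNormalForm.imp {X Y : Set (Assignment σ)} (hX : HasNormalForm h σ X)
    (hY : HasNormalForm h σ Y) : HasNormalForm h σ {ρ | ρ ∈ X → ρ ∈ Y} :=
  (hX.compl.union hY).congr fun _ => imp_iff_not_or.symm

/-- Every formula of the expansion has a normal form. -/
theorem hasNormalForm_realize (halt : β.IsAlt) (hsep : IsSeparatedSystem β)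
    (φ : MSFormula (expLanguage β h) σ) :
    HasNormalForm h σ {ρ | φ.Realize (expStructure β h) ρ} := by
  induction φ with
  | falsum => exact HasNormalForm.const False
  | @equal ι σ s t t' =>
    by_cases hs : s = .target
    · subst hs
      exact IsTermFun.setOf_eq ⟨t, fun _ => rfl⟩ ⟨t', fun _ => rfl⟩
    · let _ := codedSort s hs
      exact (isObservable_term t hs).setOf_eq (isObservable_term t' hs)
  | @rel ι σ r ts =>
    cases r
    have h0 : IsObservable h σ (A := V) fun ρ => (ts (0 : Fin 2)).eval (expStructure β h) ρ :=
      isObservable_term (ts (0 : Fin 2)) nofun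
    have h1 : IsObservable h σ (A := V) fun ρ => (ts (1 : Fin 2)).eval (expStructure β h) ρ :=
      isObservable_term (ts (1 : Fin 2)) nofun
    exact (h0.prodMk h1).preimage dSet_form_eq_zero
  | imp φ ψ ih1 ih2 => exact ih1.imp ih2
  | all s φ ih =>
    exact (ih.compl.exists_extend halt hsep).compl.congr fun _ => not_exists_not

end Elimination

/-! ### Formulas of the bilinear system -/

section System

variable {p : ℕ} [Fact p.Prime] {V W : Type u} [AddCommGroup V] [Module (ZMod p) V]
  [AddCommGroup W] [Module (ZMod p) W] {β : V →ₗ[ZMod p] V →ₗ[ZMod p] W}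
  {h : OrderDefinable β} {ι : Type} {σ : ι → ExpSort β}

variable (h) in
/-- The map from assignments to `W` takes values of bounded order, and it is determined by
observables. -/
def IsBoundedObservable (σ : ι → ExpSort β) (G : Assignment σ → W) : Prop :=
  ∃ n, (∀ ρ, G ρ ∈ orderRange β n) ∧ IsObservable h σ fun ρ => orderFun h n (G ρ)

theorem IsBoundedObservable.smul_add_smul (halt : β.IsAlt) (hsep : IsSeparatedSystem β)
    {F G : Assignment σ → W} (hF : IsBoundedObservable h σ F) (hG : IsBoundedObservable h σ G)
    (c d : ZMod p) : IsBoundedObservable h σ fun ρ => c • F ρ + d • G ρ := by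
  obtain ⟨n, hn, hF⟩ := hF
  obtain ⟨m, hm, hG⟩ := hG
  refine ⟨n + m, fun ρ => add_mem_orderRange halt (smul_mem_orderRange halt (hn ρ) c)
    (smul_mem_orderRange halt (hm ρ) d), ?_⟩
  convert (hF.prodMk hG).comp (((isChartQuadratic_orderVal n).map₂ (isChartQuadratic_orderVal m)
    c d).dMap_orderLift (h := h) halt hsep (n + m)) using 2 with ρ
  rw [orderVal_orderFun (hn ρ), orderVal_orderFun (hm ρ)]
  rfl

theorem isBoundedObservable_form (halt : β.IsAlt) (hsep : IsSeparatedSystem β)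
    {f g : Assignment σ → V} (hf : IsObservable h σ f) (hg : IsObservable h σ g) :
    IsBoundedObservable h σ fun ρ => β (f ρ) (g ρ) := by
  refine ⟨2, fun ρ => form_mem_orderRange halt _ _, ?_⟩
  have hF : IsChartQuadratic β fun q : V × V => some (β q.1 q.2) := fun i =>
    .inr ⟨_, form_mem_quadratic (.inl ()) (.inr ()), fun x => rfl⟩
  exact (hf.prodMk hg).comp (hF.dMap_orderLift (h := h) halt hsep 2)

theorem IsBoundedObservable.zero (halt : β.IsAlt) (hsep : IsSeparatedSystem β) :
    IsBoundedObservable h σ fun _ => 0 := by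
  have h0 : IsObservable h σ fun _ => (0 : V) := IsObservable.const dSet_singleton_zero
  simpa using isBoundedObservable_form halt hsep h0 h0

variable (h) in
/-- The sums of a map given by a term of the expansion and of a map whose values are of bounded
order: the maps given by the terms of sort `W` of the bilinear system are of this form. -/
def IsMixed (σ : ι → ExpSort β) (f : Assignment σ → W) : Prop :=
  ∃ F G, IsTermFun h σ F ∧ IsBoundedObservable h σ G ∧ ∀ ρ, f ρ = F ρ + G ρ

theorem IsMixed.add (halt : β.IsAlt) (hsep : IsSeparatedSystem β) {f g : Assignment σ → W}
    (hf : IsMixed h σ f) (hg : IsMixed h σ g) : IsMixed h σ fun ρ => f ρ + g ρ := by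
  obtain ⟨F, G, hF, hG, hf⟩ := hf
  obtain ⟨F', G', hF', hG', hg⟩ := hg
  refine ⟨_, _, hF.add hF', hG.smul_add_smul halt hsep hG' 1 1, fun ρ => ?_⟩
  simp only [hf, hg, one_smul]
  abel

/-- An equation `F + G = F' + G'`, with `G` and `G'` of bounded order, means that `F - F'` has
bounded order too and that its image in some `Bₙ` is that of `G' - G`. -/
theorem IsMixed.setOf_eq (halt : β.IsAlt) (hsep : IsSeparatedSystem β) {f g : Assignment σ → W}
    (hf : IsMixed h σ f) (hg : IsMixed h σ g) : HasNormalForm h σ {ρ | f ρ = g ρ} := by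
  obtain ⟨F, G, hF, hG, hf⟩ := hf
  obtain ⟨F', G', hF', hG', hg⟩ := hg
  obtain ⟨n, hn, hd⟩ := hG'.smul_add_smul halt hsep hG 1 (-1)
  refine (((hF.sub hF').isObservable_orderFun n).setOf_eq hd).congr fun ρ => ?_
  have h1 : f ρ = g ρ ↔ F ρ - F' ρ = (1 : ZMod p) • G' ρ + (-1 : ZMod p) • G ρ := by
    rw [hf, hg, one_smul, neg_one_smul, sub_eq_iff_eq_add, ← eq_sub_iff_add_eq]
    refine iff_of_eq (congrArg _ ?_)
    abel
  rw [Set.mem_ofPred_eq, Set.mem_ofPred_eq, h1]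
  constructor
  · intro h2
    have h3 := congrArg (orderVal h n) h2
    rw [orderVal_orderFun (hn ρ)] at h3
    exact (orderVal_orderFun_eq_some.1 h3).2
  · exact fun h2 => congrArg _ h2

variable (β) in
/-- The sorts of the bilinear system, as sorts of the expansion. -/
def SystemSort.toExp : SystemSort → ExpSort β
  | .vec => .vec
  | .target => .target

/-- The identification of the carriers of the bilinear system with carriers of the expansion. -/
def systemCast : {s : SystemSort} → {e : ExpSort β} → e = s.toExp β → expCarrier β e →
    (systemStructure β).carrier s
  | .vec, _, rfl, x => x
  | .target, _, rfl, x => x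

variable (h) in
/-- The maps on assignments which are given by the terms of sort `s` of the bilinear system. -/
def IsSystemFun (σ : ι → ExpSort β) :
    (s : SystemSort) → (Assignment σ → (systemStructure β).carrier s) → Prop
  | .vec, f => IsObservable h σ (A := V) f
  | .target, f => IsMixed h σ f

theorem isSystemFun_cast (halt : β.IsAlt) (hsep : IsSeparatedSystem β) :
    ∀ {s : SystemSort} (i : ι) (hi : σ i = s.toExp β),
      IsSystemFun h σ s fun ρ => systemCast hi (ρ i)
  | .target, i, hi => by
    refine ⟨_, _, IsTermFun.var i hi, IsBoundedObservable.zero halt hsep, fun ρ => ?_⟩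
    rw [add_zero]
    have : ∀ {e : ExpSort β} (he : e = .target) (a : expCarrier β e),
        systemCast (s := .target) he a = targetCast he a := by
      rintro _ rfl a
      rfl
    exact this hi (ρ i)
  | .vec, i, hi => by
    have : ∀ {e : ExpSort β} (he : e = .vec) (hne : e ≠ .target)
        (f : Assignment σ → expCarrier β e),
        @IsObservable _ _ _ _ _ _ _ _ _ h _ σ _ (codedSort e hne) f →
          IsObservable h σ (A := V) fun ρ => systemCast (s := .vec) he (f ρ) := by
      rintro _ rfl _ f hf
      exact hf
    exact this hi (hi.trans_ne nofun) _ (IsObservable.eval (Observable.var i (hi.trans_ne nofun)))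

/-- A term of sort `V` of the bilinear system is built from variables of sort `V` only; a term of
sort `W` is the sum of a combination of variables of sort `W` and of values of `β`, and the latter
have bounded order. -/
theorem isSystemFun_term (halt : β.IsAlt) (hsep : IsSeparatedSystem β) {σ' : ι → SystemSort}
    (hσ : ∀ i, σ i = (σ' i).toExp β) {s : SystemSort} (t : MSTerm systemLanguage σ' s) :
    IsSystemFun h σ s fun ρ => t.eval (systemStructure β) fun i => systemCast (hσ i) (ρ i) := by
  induction t with
  | var i => exact isSystemFun_cast halt hsep i (hσ i)
  | func f ts ih =>
    cases f with
    | vecZero => exact IsObservable.const (A := V) dSet_singleton_zero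
    | vecAdd =>
      have h0 : IsObservable h σ (A := V) fun ρ => (ts (0 : Fin 2)).eval (systemStructure β)
        fun i => systemCast (hσ i) (ρ i) := ih (0 : Fin 2)
      have h1 : IsObservable h σ (A := V) fun ρ => (ts (1 : Fin 2)).eval (systemStructure β)
        fun i => systemCast (hσ i) (ρ i) := ih (1 : Fin 2)
      exact (h0.prodMk h1).comp dMap_add
    | targetZero =>
      exact ⟨_, _, IsTermFun.zero, IsBoundedObservable.zero halt hsep, fun _ => (add_zero _).symm⟩
    | targetAdd =>
      have h0 : IsMixed h σ fun ρ => (ts (0 : Fin 2)).eval (systemStructure β)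
        fun i => systemCast (hσ i) (ρ i) := ih (0 : Fin 2)
      have h1 : IsMixed h σ fun ρ => (ts (1 : Fin 2)).eval (systemStructure β)
        fun i => systemCast (hσ i) (ρ i) := ih (1 : Fin 2)
      exact h0.add halt hsep h1
    | form =>
      have h0 : IsObservable h σ (A := V) fun ρ => (ts (0 : Fin 2)).eval (systemStructure β)
        fun i => systemCast (hσ i) (ρ i) := ih (0 : Fin 2)
      have h1 : IsObservable h σ (A := V) fun ρ => (ts (1 : Fin 2)).eval (systemStructure β)
        fun i => systemCast (hσ i) (ρ i) := ih (1 : Fin 2)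
      exact ⟨_, _, IsTermFun.zero, isBoundedObservable_form halt hsep h0 h1,
        fun _ => (zero_add _).symm⟩

theorem systemCast_surjective {s : SystemSort} {e : ExpSort β} (he : e = s.toExp β) :
    Function.Surjective (systemCast he) := by
  subst he
  cases s <;> exact Function.surjective_id

/-- Every formula of the bilinear system has a normal form. -/
theorem hasNormalForm_realize_system (halt : β.IsAlt) (hsep : IsSeparatedSystem β)
    {σ' : ι → SystemSort} (hσ : ∀ i, σ i = (σ' i).toExp β) (φ : MSFormula systemLanguage σ') :
    HasNormalForm h σ {ρ | φ.Realize (systemStructure β) fun i => systemCast (hσ i) (ρ i)} := by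
  induction φ with
  | falsum => exact HasNormalForm.const False
  | @equal ι σ' s t t' =>
    have h0 := isSystemFun_term halt hsep hσ t (h := h)
    have h1 := isSystemFun_term halt hsep hσ t' (h := h)
    cases s with
    | vec => exact IsObservable.setOf_eq (A := V) h0 h1
    | target => exact IsMixed.setOf_eq halt hsep h0 h1
  | rel r ts => exact r.elim
  | imp φ ψ ih1 ih2 => exact (ih1 hσ).imp (ih2 hσ)
  | @all ι σ' s φ ih =>
    have hσ' : ∀ i, extendContext (s.toExp β) σ i = (extendContext s σ' i).toExp β := by
      rintro (_ | i)
      · rfl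
      · exact hσ i
    refine ((ih hσ').compl.exists_extend halt hsep).compl.congr fun ρ => not_exists_not.trans ?_
    rw [Set.mem_ofPred_eq, MSFormula.Realize,
      (systemCast_surjective (s := s) (e := s.toExp β) rfl).forall]
    refine forall_congr' fun a => iff_of_eq (congrArg (φ.Realize (systemStructure β)) (funext ?_))
    rintro (_ | i) <;> rfl

end System

/-! ### From definable sets to formulas -/

section Formulas

/-- Stable embeddedness of a sort which carries the structure `(V, +, 0, R)`, from the definability
in `(V, +, 0, R)`, with parameters from the sort, of the traces of definable sets. -/
theorem ExtendsBase.isStablyEmbedded {S : Type v} {L : MSLanguage.{v, w} S} {M : MSStructure.{u} L}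
    {T : Set S} {s : S} [baseLanguage.Structure (M.carrier s)] (h : ExtendsBase M T s)
    (hM : ∀ (k m : ℕ) (σ : Fin m → S) (φ : MSFormula L (Sum.elim (fun _ : Fin k => s) σ)),
      ∃ Ψ : List (Σ l : ℕ, {Z : Set (Fin k ⊕ Fin l → M.carrier s) //
          (∅ : Set (M.carrier s)).Definable baseLanguage Z}),
        ∀ b : ∀ j, M.carrier (σ j), ∃ ψ ∈ Ψ, ∃ c : Fin ψ.1 → M.carrier s,
          ∀ x : Fin k → M.carrier s,
            φ.Realize M (sumAssignment x b) ↔ Sum.elim x c ∈ ψ.2.1) :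
    IsStablyEmbedded M s := by
  intro k m σ φ
  obtain ⟨Ψ, hΨ⟩ := hM k m σ φ
  have hform : ∀ ψ : Σ l : ℕ, {Z : Set (Fin k ⊕ Fin l → M.carrier s) //
      (∅ : Set (M.carrier s)).Definable baseLanguage Z},
      ∃ θ : MSFormula L (Sum.elim (fun _ : Fin k => s) (fun _ : Fin ψ.1 => s)),
        ∀ (x : Fin k → M.carrier s) (c : Fin ψ.1 → M.carrier s),
          θ.Realize M (sumAssignment x c) ↔ Sum.elim x c ∈ ψ.2.1 := by
    rintro ⟨l, Z, hZ⟩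
    obtain ⟨φ, -, rfl⟩ := h.msDefinable hZ
    let τ : Fin k ⊕ Fin l → S := Sum.elim (fun _ => s) fun _ => s
    let f : ∀ _ : Fin k ⊕ Fin l, MSTerm L τ s
      | .inl i => .var (σ := τ) (.inl i)
      | .inr j => .var (σ := τ) (.inr j)
    refine ⟨φ.subst f, fun x c => (φ.realize_subst M f _).trans ?_⟩
    refine iff_of_eq (congrArg (φ.Realize M) (funext fun z => ?_))
    rcases z with i | j <;> rfl
  choose θ hθ using hform
  refine ⟨Ψ.map fun ψ => ⟨ψ.1, θ ψ⟩, fun b => ?_⟩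
  obtain ⟨ψ, hψ, c, hc⟩ := hΨ b
  exact ⟨_, List.mem_map_of_mem hψ, c, fun x => (hc x).trans (hθ ψ x c).symm⟩

variable {p : ℕ} [Fact p.Prime] {V W : Type u} [AddCommGroup V] [Module (ZMod p) V]
  [AddCommGroup W] [Module (ZMod p) W] {β : V →ₗ[ZMod p] V →ₗ[ZMod p] W}
  {h : OrderDefinable β} {ι : Type} {σ : ι → ExpSort β}

/-- The sort `V` of the expansion as a structure for the language of `(V, +, 0, R)`. -/
instance : baseLanguage.Structure ((expStructure β h).carrier .vec) :=
  (baseStructure β : baseLanguage.Structure V)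

/-- The sort `V` of the bilinear system as a structure for the language of `(V, +, 0, R)`. -/
instance : baseLanguage.Structure ((systemStructure β).carrier .vec) :=
  (baseStructure β : baseLanguage.Structure V)

theorem extendsBase_expStructure :
    ExtendsBase (expStructure β h) (eqSorts β) ExpSort.vec where
  mem := nofun
  zero σ := ⟨.func (L := expLanguage β h) ExpFunc.vecZero fun i => Fin.elim0 i,
    ⟨nofun, fun i => Fin.elim0 i⟩, fun _ => rfl⟩
  add {ι σ} t t' ht ht' := by
    refine ⟨.func (L := expLanguage β h) ExpFunc.vecAdd
      (fun i : Fin 2 => (![t, t'] : Fin 2 → MSTerm (expLanguage β h) σ .vec) i),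
      ⟨nofun, ?_⟩, fun _ => rfl⟩
    change ∀ i : Fin 2, _
    rw [Fin.forall_fin_two]
    exact ⟨ht, ht'⟩
  rel {ι σ} t t' ht ht' := by
    refine ⟨.rel (L := expLanguage β h) ExpRel.R
      (fun i : Fin 2 => (![t, t'] : Fin 2 → MSTerm (expLanguage β h) σ .vec) i), ?_,
      fun _ => Iff.rfl⟩
    change ∀ i : Fin 2, _
    rw [Fin.forall_fin_two]
    exact ⟨ht, ht'⟩

/-- In the bilinear system, `R(v, v')` is the equation `β(v, v') = 0`. -/
theorem extendsBase_systemStructure :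
    ExtendsBase (systemStructure β) Set.univ SystemSort.vec where
  mem := trivial
  zero σ := ⟨.func (L := systemLanguage) SystemFunc.vecZero fun i => Fin.elim0 i,
    ⟨trivial, fun i => Fin.elim0 i⟩, fun _ => rfl⟩
  add {ι σ} t t' ht ht' := by
    refine ⟨.func (L := systemLanguage) SystemFunc.vecAdd
      (fun i : Fin 2 => (![t, t'] : Fin 2 → MSTerm systemLanguage σ .vec) i),
      ⟨trivial, ?_⟩, fun _ => rfl⟩
    change ∀ i : Fin 2, _
    rw [Fin.forall_fin_two]
    exact ⟨ht, ht'⟩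
  rel {ι σ} t t' ht ht' := by
    refine ⟨.equal (L := systemLanguage) (.func (L := systemLanguage) SystemFunc.form
      (fun i : Fin 2 => (![t, t'] : Fin 2 → MSTerm systemLanguage σ .vec) i))
      (.func (L := systemLanguage) SystemFunc.targetZero fun i => Fin.elim0 i),
      ⟨⟨trivial, ?_⟩, trivial, fun i => Fin.elim0 i⟩, fun _ => Iff.rfl⟩
    change ∀ i : Fin 2, _
    rw [Fin.forall_fin_two]
    exact ⟨ht, ht'⟩

/-- The charts of the sorts of `(V, +, 0, R)^eq` are given by terms: they are the projections. -/
theorem exists_term_decode : ∀ {s : ExpSort β} (hs : s ≠ .target)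
    (i : @Coded.Chart _ _ _ _ _ _ _ β _ (codedSort s hs)),
    ∃ t : MSTerm (expLanguage β h) (fun _ : @Coded.dim _ _ _ _ _ _ _ β _ (codedSort s hs) i =>
        ExpSort.vec) s, t.IsOver (eqSorts β) ∧
      ∀ x, t.eval (expStructure β h) x = @Coded.decode _ _ _ _ _ _ _ β _ (codedSort s hs) i x
  | .vec, _, _ => ⟨.var (σ := fun _ : Unit => ExpSort.vec) (), nofun, fun _ => rfl⟩
  | .imag E, _, i => ⟨.func (L := expLanguage β h) (ExpFunc.proj E i) fun j : Fin (E.n i) =>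
      .var (σ := fun _ : Fin (E.n i) => ExpSort.vec) j, ⟨nofun, fun _ => nofun⟩, fun _ => rfl⟩
  | .target, hs, _ => absurd rfl hs

/-- A set definable in the sense of coded types is defined by a formula of `(V, +, 0, R)^eq`. -/
theorem DSet.msDefinable {J : Type} [Finite J] {τ : J → ExpSort β} (hτ : ∀ j, τ j ≠ .target)
    {D : Set (∀ j, expCarrier β (τ j))}
    (hD : @DSet _ _ _ _ _ _ _ β (∀ j, expCarrier β (τ j))
      (@Coded.pi _ _ _ _ _ _ _ β J _ _ fun j => codedSort (τ j) (hτ j)) D) :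
    MSDefinable (expStructure β h) (eqSorts β) τ D := by
  let _ : ∀ j, Coded β (expCarrier β (τ j)) := fun j => codedSort (τ j) (hτ j)
  have hvec : ExpSort.vec ∈ eqSorts β := nofun
  have key : ∀ c : (∀ j, Coded.Chart β (expCarrier β (τ j))),
      MSDefinable (expStructure β h) (eqSorts β) τ
        {ρ | ∃ x : (Σ j, Coded.dim (c j)) → V,
          (∀ j, Coded.decode (c j) (fun t => x ⟨j, t⟩) = ρ j) ∧
            (fun j => Coded.decode (β := β) (c j) fun t => x ⟨j, t⟩) ∈ D} := by
    intro c
    let τ' : J ⊕ (Σ j, Coded.dim (c j)) → ExpSort β := Sum.elim τ fun _ => ExpSort.vec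
    have h1 : MSDefinable (expStructure β h) (eqSorts β) τ'
        {z | (fun j => Coded.decode (β := β) (c j) fun t => z (.inr ⟨j, t⟩)) ∈ D} :=
      (extendsBase_expStructure.msDefinable (hD c)).subst (τ := τ')
        (fun k => .var (σ := τ') (.inr k))
        fun _ => hvec
    have h2 : ∀ j, MSDefinable (expStructure β h) (eqSorts β) τ'
        {z | Coded.decode (β := β) (c j) (fun t => z (.inr ⟨j, t⟩)) = z (.inl j)} := by
      intro j
      obtain ⟨t, ht, heval⟩ := exists_term_decode (h := h) (hτ j) (c j)
      let f : ∀ k : Coded.dim (c j), MSTerm (expLanguage β h) τ' ExpSort.vec :=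
        fun k => .var (σ := τ') (.inr ⟨j, k⟩)
      have hf : ∀ k, (f k).IsOver (eqSorts β) := fun _ => hvec
      refine ⟨.equal (t.subst f) (.var (σ := τ') (.inl j)), ⟨t.isOver_subst _ f hf ht, hτ j⟩,
        Set.ext fun z => ?_⟩
      have h3 := (MSTerm.eval_subst (expStructure β h) f z t).trans (heval _)
      exact ⟨fun hz => h3.trans hz, fun hz => h3.symm.trans hz⟩
    refine (MSDefinable.exists_tuple (s := ExpSort.vec) hτ
      hvec ((MSDefinable.iInter h2).inter h1)).congr fun ρ => exists_congr fun x => ?_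
    rw [Set.mem_inter_iff, Set.mem_iInter]
    rfl
  refine (MSDefinable.iUnion key).congr fun ρ => ?_
  rw [Set.mem_iUnion]
  constructor
  · rintro ⟨c, x, hx, hx'⟩
    rwa [funext hx] at hx'
  · intro hρ
    obtain ⟨c, x, hx⟩ := Coded.surj (β := β) (A := ∀ j, expCarrier β (τ j)) ρ
    refine ⟨c, x, fun j => congrFun hx j, ?_⟩
    rw [← hx] at hρ
    exact hρ

/-- A normal form is a formula of `(V, +, 0, R)^eq` applied to terms, hence quantifier-free relative
to the sorts of `(V, +, 0, R)^eq`. -/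
theorem HasNormalForm.isRelQFDefinable {X : Set (Assignment σ)} (hX : HasNormalForm h σ X) :
    IsRelQFDefinable (expStructure β h) (eqSorts β) σ X := by
  obtain ⟨J, hJ, O, D, hD, hX⟩ := hX
  obtain ⟨θ, hθ, rfl⟩ := DSet.msDefinable (h := h) (fun j => (O j).sort_ne) hD
  -- the definition of relative quantifier-freeness requires the index set `Fin n`
  obtain ⟨n, ⟨e⟩⟩ := Finite.exists_equiv_fin J
  let τ : Fin n → ExpSort β := fun k => (O (e.symm k)).sort
  have hvar : ∀ j, ∃ t : MSTerm (expLanguage β h) τ (O j).sort, t.IsOver (eqSorts β) ∧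
      ∀ ρ : Assignment σ, t.eval (expStructure β h) (fun k => (O (e.symm k)).eval ρ) =
        (O j).eval ρ := by
    intro j
    obtain ⟨k, rfl⟩ := e.symm.surjective j
    exact ⟨.var (σ := τ) k, (O (e.symm k)).sort_ne, fun _ => rfl⟩
  choose f hf hf' using hvar
  have hterm : ∀ O : Observable h σ, ∃ t : MSTerm (expLanguage β h) σ O.sort,
      ∀ ρ, t.eval (expStructure β h) ρ = O.eval ρ := by
    rintro (⟨n, t⟩ | ⟨i, hi⟩)
    · exact ⟨.func (L := expLanguage β h) (ExpFunc.order n) fun _ : Fin 1 => t, fun _ => rfl⟩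
    · exact ⟨.var i, fun _ => rfl⟩
  choose t ht using hterm
  have hX' : X = {ρ | (θ.subst f).Realize (expStructure β h) fun k =>
      (t (O (e.symm k))).eval (expStructure β h) ρ} := by
    ext ρ
    refine (hX ρ).trans (Iff.trans ?_ (θ.realize_subst (expStructure β h) f _).symm)
    refine iff_of_eq (congrArg (θ.Realize (expStructure β h)) (funext fun j => ?_))
    exact (hf' j ρ).symm.trans (congrArg (fun ρ => MSTerm.eval (expStructure β h) ρ (f j))
      (funext fun k => (ht _ _).symm))
  rw [hX']
  exact .over τ (fun k => (O (e.symm k)).sort_ne) (θ.subst f) (θ.isOver_subst _ f hf hθ) _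

/-- The normal form for formulas in variables of sorts `V` and `W` only. -/
theorem HasNormalForm.isNormalForm (halt : β.IsAlt) (hsep : IsSeparatedSystem β) {m k : ℕ}
    {X : Set (Assignment (Sum.elim (fun _ : Fin m => ExpSort.target (β := β))
      (fun _ : Fin k => ExpSort.vec)))} (hX : HasNormalForm h _ X) :
    IsNormalForm β h m k {y | (sumAssignment (C := expCarrier β) y.1 y.2 : Assignment _) ∈ X} := by
  have hterm : ∀ t : MSTerm (expLanguage β h) (Sum.elim (fun _ : Fin m => ExpSort.target (β := β))
      (fun _ : Fin k => ExpSort.vec)) .target, ∃ a : Fin m → ZMod p,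
        ∀ (w : Fin m → W) (v : Fin k → V), t.eval (expStructure β h)
          (sumAssignment (C := expCarrier β) w v) = ∑ i, a i • w i := by
    refine fun t => IsTermFun.induction (P := fun f => ∃ a : Fin m → ZMod p,
        ∀ (w : Fin m → W) (v : Fin k → V), f (sumAssignment (C := expCarrier β) w v) =
          ∑ i, a i • w i) ?_ ?_ ?_ t
    · rintro (i | i) hi
      · exact ⟨Pi.single i 1, fun w v => by simp [Pi.single_apply, ite_smul]; rfl⟩
      · exact nomatch hi
    · exact ⟨0, fun w v => by simp⟩
    · rintro f g ⟨a, hf⟩ ⟨b, hg⟩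
      exact ⟨a + b, fun w v => (congrArg₂ (· + ·) (hf w v) (hg w v)).trans
        (by simp [add_smul, Finset.sum_add_distrib])⟩
  have hobs : ∀ O : Observable h (Sum.elim (fun _ : Fin m => ExpSort.target (β := β))
      (fun _ : Fin k => ExpSort.vec)), ∃ (a : Fin m → ZMod p) (n : ℕ), ∀ N, n ≤ N →
        ∃ H : OrdSort h N × (Fin k → V) → expCarrier β O.sort, DMap β H ∧
          ∀ (w : Fin m → W) (v : Fin k → V), O.eval (sumAssignment (C := expCarrier β) w v) =
            H (orderFun h N (∑ i, a i • w i), v) := by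
    rintro (⟨n, t⟩ | ⟨i | i, hi⟩)
    · obtain ⟨a, ha⟩ := hterm t
      refine ⟨a, n, fun N hN => ⟨fun q => orderLift h n (orderVal h N q.1),
        ((isChartQuadratic_orderVal N).dMap_orderLift halt hsep n).comp DMap.fst, fun w v => ?_⟩⟩
      exact (congrArg (orderFun h n) (ha w v)).trans (orderLift_orderVal halt hN _).symm
    · exact absurd rfl hi
    · exact ⟨0, 0, fun N _ => ⟨fun q => q.2 i,
        (DMap.eval (F := fun _ : Fin k => V) i).comp DMap.snd, fun w v => rfl⟩⟩
  obtain ⟨J, hJ, O, D, hD, hX⟩ := hX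
  have := Fintype.ofFinite J
  obtain ⟨q, ⟨e⟩⟩ := Finite.exists_equiv_fin J
  choose a n hO using fun j => hobs (O j)
  choose H hH hO using fun j => hO j (∑ j, n j)
    (Finset.single_le_sum (fun _ _ => Nat.zero_le _) (Finset.mem_univ j))
  -- a single `N` above all the indices `n j` serves for all the observables
  let N := ∑ j, n j
  let τ : Fin q ⊕ Fin k → ExpSort β := Sum.elim (fun _ => ExpSort.imag (orderSort β h N))
    fun _ => ExpSort.vec
  have hτ : ∀ z, τ z ≠ .target := by
    rintro (j | j) <;> exact nofun
  let _ : ∀ z, Coded β (expCarrier β (τ z)) := fun z => codedSort (τ z) (hτ z)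
  have hproj : ∀ j, DMap β fun z : (∀ z, expCarrier β (τ z)) =>
      ((z (.inl (e j)), fun i => z (.inr i)) : OrdSort h N × (Fin k → V)) := fun j =>
    (DMap.eval (F := fun z => expCarrier β (τ z)) (.inl (e j))).prodMk
      (DMap.pi fun i => DMap.eval (F := fun z => expCarrier β (τ z)) (.inr i))
  have hD' : DSet β {z : ∀ z, expCarrier β (τ z) |
      (fun j => H j (z (.inl (e j)), fun i => z (.inr i))) ∈ D} :=
    (DMap.pi fun j => (hH j).comp (hproj j)).preimage hD
  obtain ⟨θ, hθ, hθ'⟩ := DSet.msDefinable (h := h) hτ hD'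
  have := IsNormalForm.over (h := h) (m := m) N q (fun j => a (e.symm j)) θ hθ
  convert this using 1
  ext y
  have h1 := Set.ext_iff.1 hθ' (sumAssignment (C := expCarrier β)
    (fun j => orderFun h N (∑ i, a (e.symm j) i • y.1 i)) y.2)
  refine Iff.trans ?_ h1
  rw [Set.mem_ofPred_eq, hX]
  refine iff_of_eq (congrArg (· ∈ D) (funext fun j => ?_))
  rw [hO]
  simp only [sumAssignment, Equiv.symm_apply_apply]
  rfl

/-- The trace on `V^k` of a set in normal form. The observables are either coordinates of the
variable `x` of sort `V`, or they depend on the parameters `b` only; in the latter case they are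
elements of coded types, and their coordinates in a chart serve as parameters in `V`. -/
theorem HasNormalForm.exists_list {k m : ℕ} {σ : Fin m → ExpSort β}
    {X : Set (Assignment (Sum.elim (fun _ : Fin k => ExpSort.vec (β := β)) σ))}
    (hX : HasNormalForm h _ X) :
    ∃ Ψ : List (Σ l : ℕ, {Z : Set (Fin k ⊕ Fin l → V) // IsBaseDefinable β Z}),
      ∀ b : Assignment σ, ∃ ψ ∈ Ψ, ∃ c : Fin ψ.1 → V, ∀ x : Fin k → V,
        (sumAssignment (C := expCarrier β) x b : Assignment _) ∈ X ↔ Sum.elim x c ∈ ψ.2.1 := by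
  have hterm : ∀ t : MSTerm (expLanguage β h) (Sum.elim (fun _ : Fin k => ExpSort.vec (β := β)) σ)
      .target, ∃ F : Assignment σ → W, ∀ (x : Fin k → V) (b : Assignment σ),
        t.eval (expStructure β h) (sumAssignment (C := expCarrier β) x b) = F b := by
    refine fun t => IsTermFun.induction (P := fun f => ∃ F : Assignment σ → W,
      ∀ (x : Fin k → V) (b : Assignment σ), f (sumAssignment (C := expCarrier β) x b) = F b)
      ?_ ?_ ?_ t
    · rintro (i | i) hi
      · exact nomatch hi
      · exact ⟨fun b => targetCast hi (b i), fun _ _ => rfl⟩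
    · exact ⟨fun _ => 0, fun _ _ => rfl⟩
    · rintro f g ⟨F, hf⟩ ⟨G, hg⟩
      exact ⟨fun b => F b + G b, fun x b => congrArg₂ (· + ·) (hf x b) (hg x b)⟩
  have hobs : ∀ O : Observable h (Sum.elim (fun _ : Fin k => ExpSort.vec (β := β)) σ),
      ∃ (A : Type u) (_ : Coded β A) (Φ : Assignment σ → A)
        (H : (Fin k → V) × A → expCarrier β O.sort), DMap β H ∧
          ∀ (x : Fin k → V) (b : Assignment σ),
            O.eval (sumAssignment (C := expCarrier β) x b) = H (x, Φ b) := by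
    rintro (⟨n, t⟩ | ⟨i | i, hi⟩)
    · obtain ⟨F, hF⟩ := hterm t
      exact ⟨OrdSort h n, inferInstance, fun b => orderFun h n (F b), _, DMap.snd,
        fun x b => congrArg (orderFun h n) (hF x b)⟩
    · exact ⟨PUnit, inferInstance, fun _ => PUnit.unit, _,
        (DMap.eval (F := fun _ : Fin k => V) i).comp DMap.fst, fun x b => rfl⟩
    · exact ⟨_, codedSort (σ i) hi, fun b => b i, _, DMap.snd, fun x b => rfl⟩
  obtain ⟨J, hJ, O, D, hD, hX⟩ := hX
  choose A hA Φ H hH hO using fun j => hobs (O j)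
  have hD' : DSet β {q : (Fin k → V) × (∀ j, A j) | (fun j => H j (q.1, q.2 j)) ∈ D} :=
    (DMap.pi fun j => (hH j).comp (DMap.fst.prodMk ((DMap.eval j).comp DMap.snd))).preimage hD
  -- one formula for each chart; the parameters are the coordinates in this chart
  have hchart : ∀ i : Coded.Chart β (∀ j, A j), ∃ ψ : Σ l : ℕ, {Z : Set (Fin k ⊕ Fin l → V) //
      IsBaseDefinable β Z}, ∀ y, ∃ c : Fin ψ.1 → V, ∀ x : Fin k → V,
        (fun j => H j (x, Coded.decode i y j)) ∈ D ↔ Sum.elim x c ∈ ψ.2.1 := by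
    intro i
    obtain ⟨l, ⟨e⟩⟩ := Finite.exists_equiv_fin (Coded.dim i)
    refine ⟨⟨l, _, (hD' (fun _ => (), i)).comp
      (Sum.map (Sigma.fst : (Σ _ : Fin k, Unit) → Fin k) e)⟩, fun y => ⟨y ∘ e.symm, fun x => ?_⟩⟩
    have : y = fun t => (y ∘ e.symm) (e t) := funext fun t => by simp
    conv_lhs => rw [this]
    rfl
  choose ψ hψ using hchart
  have := Fintype.ofFinite (Coded.Chart β (∀ j, A j))
  refine ⟨(Finset.univ.toList).map ψ, fun b => ?_⟩
  obtain ⟨i, y, hy⟩ := Coded.surj (β := β) fun j => Φ j b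
  obtain ⟨c, hc⟩ := hψ i y
  refine ⟨ψ i, List.mem_map_of_mem (Finset.mem_toList.2 (Finset.mem_univ i)), c, fun x => ?_⟩
  rw [← hc, hy, hX]
  simp only [hO]

/-- A subset of `V^k` in normal form is definable in `(V, +, 0, R)`: the terms of sort `W` without
variables of sort `W` are equal to `0`. -/
theorem HasNormalForm.isBaseDefinable (halt : β.IsAlt) (hsep : IsSeparatedSystem β) {k : ℕ}
    {X : Set (Fin k → V)} (hX : HasNormalForm h (fun _ : Fin k => ExpSort.vec (β := β)) X) :
    IsBaseDefinable β X := by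
  have hobs : ∀ O : Observable h (fun _ : Fin k => ExpSort.vec (β := β)),
      DMap β fun x : Fin k → V => O.eval x := by
    rintro (⟨n, t⟩ | ⟨i, hi⟩)
    · have ht : ∀ x, t.eval (expStructure β h) x = (0 : W) := by
        refine IsTermFun.induction (P := fun f => ∀ x, f x = (0 : W)) ?_ ?_ ?_ t
        · exact fun _ hi => nomatch hi
        · exact fun _ => rfl
        · exact fun f g hf hg x => (congrArg₂ (· + ·) (hf x) (hg x)).trans (add_zero _)
      have h0 : IsChartQuadratic β fun _ : Fin k → V => some (0 : W) := fun i =>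
        .inr ⟨0, Submodule.zero_mem _, fun _ => rfl⟩
      have h1 := h0.dMap_orderLift (h := h) halt hsep n
      have h2 : (fun x : Fin k → V => (Observable.ord (h := h) n t).eval x) =
          fun _ => orderFun h n 0 := funext fun x => congrArg (orderFun h n) (ht x)
      rw [h2]
      exact h1
    · exact DMap.eval (F := fun _ : Fin k => V) i
  obtain ⟨J, hJ, O, D, hD, hX⟩ := hX
  rw [← dSet_iff_isBaseDefinable]
  exact ((DMap.pi fun j => hobs (O j)).preimage hD).congr fun x => (hX x).symm

end Formulas

theorem mainTheorem10 {p : ℕ} [Fact p.Prime] {V W : Type u}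
    [AddCommGroup V] [Module (ZMod p) V] [AddCommGroup W] [Module (ZMod p) W]
    (β : V →ₗ[ZMod p] V →ₗ[ZMod p] W) (halt : β.IsAlt) (hsep : IsSeparatedSystem β) :
    -- the sets `Bₙ` are imaginary sorts of `(V, +, 0, R)`
    ∃ h : OrderDefinable β,
      -- relative quantifier elimination
      EliminatesQuantifiersRelativeTo (expStructure β h) (eqSorts β) ∧
      -- the resulting normal form of formulas of the bilinear system
      (∀ (m k : ℕ) (φ : MSFormula systemLanguage
          (Sum.elim (fun _ : Fin m => SystemSort.target) (fun _ : Fin k => SystemSort.vec))),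
        IsNormalForm β h m k
          {y | φ.Realize (systemStructure β)
            (sumAssignment (C := (systemStructure β).carrier) y.1 y.2)}) ∧
      -- `V` is stably embedded, with induced structure `(V, +, 0, R)`
      (IsStablyEmbedded (expStructure β h) ExpSort.vec ∧
        ∀ (k : ℕ) (X : Set (Fin k → V)),
          IsSortDefinable (expStructure β h) ExpSort.vec X ↔ IsBaseDefinable β X) ∧
      (IsStablyEmbedded (systemStructure β) SystemSort.vec ∧
        ∀ (k : ℕ) (X : Set (Fin k → V)),
          IsSortDefinable (systemStructure β) SystemSort.vec X ↔ IsBaseDefinable β X) := by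
  have h : OrderDefinable β := orderDefinable halt hsep
  refine ⟨h, ?_, ?_, ⟨?_, ?_⟩, ?_, ?_⟩
  · exact fun ι σ φ => (hasNormalForm_realize halt hsep φ).isRelQFDefinable
  · intro m k φ
    have hσ : ∀ i, Sum.elim (fun _ : Fin m => ExpSort.target (β := β))
        (fun _ : Fin k => ExpSort.vec) i = SystemSort.toExp β
          (Sum.elim (fun _ => SystemSort.target) (fun _ => SystemSort.vec) i) := by
      rintro (i | i) <;> rfl
    convert (hasNormalForm_realize_system (h := h) halt hsep hσ φ).isNormalForm halt hsep using 1
    ext y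
    refine iff_of_eq (congrArg (φ.Realize (systemStructure β)) (funext ?_))
    rintro (i | i) <;> rfl
  · exact extendsBase_expStructure.isStablyEmbedded fun k m σ φ =>
      (hasNormalForm_realize halt hsep φ).exists_list
  · refine fun k X => ⟨?_, fun hX => ?_⟩
    · rintro ⟨φ, rfl⟩
      exact (hasNormalForm_realize halt hsep φ).isBaseDefinable halt hsep
    · obtain ⟨φ, -, hφ⟩ := (extendsBase_expStructure (h := h)).msDefinable hX
      exact ⟨φ, hφ⟩
  · refine extendsBase_systemStructure.isStablyEmbedded fun k m σ φ => ?_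
    have hσ : ∀ i, Sum.elim (fun _ : Fin k => ExpSort.vec (β := β))
        (fun j => (σ j).toExp β) i = SystemSort.toExp β
          (Sum.elim (fun _ => SystemSort.vec) σ i) := by
      rintro (i | i) <;> rfl
    obtain ⟨Ψ, hΨ⟩ := (hasNormalForm_realize_system (h := h) halt hsep hσ φ).exists_list
    refine ⟨Ψ, fun b => ?_⟩
    choose b' hb' using fun j => systemCast_surjective (s := σ j) rfl (b j)
    obtain ⟨ψ, hψ, c, hc⟩ := hΨ b'
    refine ⟨ψ, hψ, c, fun x => Iff.trans ?_ (hc x)⟩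
    refine iff_of_eq (congrArg (φ.Realize (systemStructure β)) (funext ?_))
    rintro (i | i)
    · rfl
    · exact (hb' i).symm
  · refine fun k X => ⟨?_, fun hX => ?_⟩
    · rintro ⟨φ, rfl⟩
      exact (hasNormalForm_realize_system (h := h) (σ := fun _ => ExpSort.vec) halt hsep
        (fun _ => rfl) φ).isBaseDefinable halt hsep
    · obtain ⟨φ, -, hφ⟩ := (extendsBase_systemStructure (β := β)).msDefinable hX
      exact ⟨φ, hφ⟩
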